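/- Throughout, $d_F(v)$ is the degree of $v$ in a graph $F$, and $d_F(v,A)=|N_F(v)\cap A|$ for a set $A$ of vertices. A spanning subgraph $H$ of a graph $G$ (that is, $V(H)=V(G)$ and $E(H)\subseteq E(G)$) is called $\alpha$-residual if $d_H(v)\ge \alpha\, d_G(v)$ for every vertex $v$. A linear forest is a forest each of whose connected components is a path (a single vertex counts as a path); it spans $S$ if its vertex set equals $S$, and it covers $T$ if its vertex set contains $T$. **Theorem.** Let $r\ge 2$ be an integer, $C\ge 0$, $\varepsilon\in(0,\tfrac12]$ and $\alpha\in[\tfrac12+\tfrac1{2r},1]$. Then there exists $\delta>0$, depending only on $r,C,\varepsilon,\alpha$, such that for every sequence $p=p(n)\in[0,1]$ with $p\ge\frac{\log n}{2n}$ for all sufficiently large $n$, the random graph $G\sim G(n,p)$ satisfies the following with probability $1-o(n^{-3})$ as $n\to\infty$. Let $H$ be any $\alpha$-residual spanning subgraph of $G$ such that - (A1) every vertex $v$ satisfies $d_H(v)\ge 2$; - (A2) no two distinct vertices $u,v$ with $d_H(u),d_H(v)\le \frac{np}{5000}$ are within distance $5$ of each other in $H$. Let $\mathcal P$ be any linear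 forest in $H$ that spans a vertex set $S$ whose size $|S|$ is the number $(1-\varepsilon)\min\{(2\alpha-1)n,\ \frac{2\alpha n}{r},\ \frac{2n}{r+1}\}$ rounded down or up to an integer, and suppose that $\mathcal P$ consists of at most $C$ paths. Then there exist a set $T\supseteq S$ of vertices and a linear forest $\mathcal P^*$ in $H$ covering $T$ such that, with $U=V(H)\setminus T$, - (B1) $d_H(u,U)\ge\max\left(\frac{p|U|}{5000},\ \left(\tfrac12+\delta\right)d_G(u,U)\right)$ for all $u\in U$; - (B2) $|U|\ge n-|S|-\frac{300r}{\delta^2p}$; - (B3) all but at most $\frac{2000r}{\delta^2p}$ edges of $\mathcal P$ are edges of $\mathcal P^*$; - (B4) $\mathcal P^*$ consists of at most $\frac{2000r}{\delta^2p}$ paths; - (B5) every path of $\mathcal P^*$ has at least $3$ vertices, its endpoints lie in $U$, and all its other vertices lie in $T$; - (B6) if $W$ is the set of all endpoints of paths of $\mathcal P^*$, then $d_H(u,W)\le (np)^{1/5}$ for all $u\in U$. -/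

import Mathlib

open Filter Asymptotics

/-- `d_F(v, A) = |N_F(v) ∩ A|`. -/
noncomputable def degInto {V : Type*} (F : SimpleGraph V) (v : V) (A : Set V) : ℕ :=
  (F.neighborSet v ∩ A).ncard

/-- The degree `d_F(v) = |N_F(v)|`. -/
noncomputable def deg {V : Type*} (F : SimpleGraph V) (v : V) : ℕ :=
  (F.neighborSet v).ncard

/-- `H` is an `α`-residual spanning subgraph of `G`: both graphs have vertex set `V`, every edge
of `H` is an edge of `G`, and `d_H(v) ≥ α d_G(v)` for every vertex `v`. -/
def IsResidualSpanning {V : Type*} (α : ℝ) (H G : SimpleGraph V) : Prop :=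
  H ≤ G ∧ ∀ v, α * (deg G v : ℝ) ≤ (deg H v : ℝ)

/-- A graph that is a (finite) path. A single vertex is a path. -/
def IsPathGraph {V : Type*} (F : SimpleGraph V) : Prop :=
  ∃ k : ℕ, Nonempty (F ≃g SimpleGraph.pathGraph (k + 1))

/-- A linear forest in `H`: a subgraph of `H` (with its own vertex set `P.verts`) which is a forest
each of whose connected components is a path. -/
def IsLinearForest {V : Type*} {H : SimpleGraph V} (P : H.Subgraph) : Prop :=
  P.coe.IsAcyclic ∧ ∀ c : P.coe.ConnectedComponent, IsPathGraph c.toSimpleGraph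

/-- The number of paths of a linear forest, i.e. the number of its connected components. -/
noncomputable def numPaths {V : Type*} {H : SimpleGraph V} (P : H.Subgraph) : ℕ :=
  Nat.card P.coe.ConnectedComponent

/-- The set of endpoints of the paths of a linear forest: the vertices of degree at most one in it
(the only vertex of a one-vertex path is its endpoint). -/
def pathEndpoints {V : Type*} {H : SimpleGraph V} (P : H.Subgraph) : Set V :=
  {v | v ∈ P.verts ∧ (P.neighborSet v).ncard ≤ 1}

/-! Write N = np and x = N^(1/20). Three properties of G(n,p) suffice: all degrees are at most 40N;
whenever p|X| ≥ K, the number of edges between X and any A is within θN|X| of p|X||A|; and every set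
of at most 200c/p vertices has inner degree sum at most x per vertex (`LocallySparse`). Chernoff and
union bounds show that they fail with probability at most 4n^(-5). The rest is deterministic.

By the second property all but 2K/p vertices have about the expected degrees into S and into its
complement. For such a vertex the adversary removes at most a (1-α) share of the G-edges, and |S| is
smaller than (2α-1)n by a factor 1-ε, so more than half of the G-edges that leave S survive in H,
with slack 10θN (`residual_degree_bounds`). The remaining vertices D are moved into T. Sparsity lets
D, together with two neighbours of each low-degree vertex, be closed up to a set B of size O(1/p)
such that no vertex outside B has more than 3x neighbours in B. With T = S ∪ B, passing from the
complement of S to U costs at most 3x per vertex, which the slack pays for.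

The new linear forest needs degree two on T, degree at most one on U, and no edge inside U; then the
inner vertices are exactly T. The old forest is cut at B and at a few further vertices. Each vertex
of T that lacks degree two is then joined to private isolated targets (`exists_forest_extension`);
such pendant edges never close a cycle. Low-degree vertices use their chosen neighbours, which are
private because these vertices are far apart. Vertices of B with few neighbours in U use neighbours
in T that come later in a degenerate ordering of B. All others use neighbours in U. Private targets
for the last two kinds come from Hall's theorem and sparsity
(`LocallySparse.exists_private_neighbors`). For (B6), targets in U are taken from a set R meeting
every neighbourhood in at most x^4 = N^(1/5) vertices; the local lemma provides it
(`eventually_exists_sparse_transversal`). -/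

/-! ### Linear forests as acyclic graphs of maximum degree two -/

section LinearForests

open SimpleGraph

/-- A finite tree of maximum degree at most two is a path. -/
theorem isPathGraph_of_ncard_neighborSet_le_two {V : Type*} [Finite V] {F : SimpleGraph V}
    (hc : F.Connected) (ha : F.IsAcyclic) (h2 : ∀ v, (F.neighborSet v).ncard ≤ 2) :
    IsPathGraph F := by
  classical
  have := Fintype.ofFinite V
  have := hc.nonempty
  obtain ⟨u, v, p, hp, hmax⟩ := Walk.exists_isPath_forall_isPath_length_le_length F
  have hinj := hp.getVert_injOn
  have hadj : ∀ i, i < p.length → F.Adj (p.getVert i) (p.getVert (i + 1)) :=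
    fun i hi => p.adj_getVert_succ hi
  -- An edge leaving a longest path would prolong it at an end or give an inner vertex a third
  -- neighbour.
  have hsupp : ∀ w, w ∈ p.support := by
    by_contra! hw
    obtain ⟨w, hw⟩ := hw
    obtain ⟨q⟩ := hc.preconnected u w
    obtain ⟨⟨⟨a, b⟩, hab⟩, -, h1, h2'⟩ := q.exists_boundary_dart {z | z ∈ p.support}
      (by simp) (by simpa using hw)
    simp only [Set.mem_ofPred_eq] at h1 h2' hab
    obtain ⟨i, rfl, hi⟩ := Walk.mem_support_iff_exists_getVert.1 h1
    rcases Nat.eq_zero_or_pos i with rfl | hi0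
    · rw [Walk.getVert_zero] at hab
      have := hmax _ _ _ (hp.cons h2' (h := hab.symm))
      simp at this
    rcases hi.eq_or_lt with rfl | hil
    · rw [Walk.getVert_length] at hab
      have := hmax _ _ _ (hp.concat h2' hab)
      simp at this
    · have hpb : ∀ j, p.getVert j ≠ b := fun j hj => h2' (hj ▸ p.getVert_mem_support j)
      have hne : p.getVert (i - 1) ≠ p.getVert (i + 1) := by
        intro h
        have := hinj (by simp; omega) (by simp; omega) h
        omega
      have hsub : ({p.getVert (i - 1), p.getVert (i + 1), b} : Finset V) ⊆
          (F.neighborSet (p.getVert i)).toFinite.toFinset := by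
        intro z hz
        simp only [Finset.mem_insert, Finset.mem_singleton] at hz
        simp only [Set.Finite.mem_toFinset, mem_neighborSet]
        rcases hz with rfl | rfl | rfl
        · have := hadj (i - 1) (by omega)
          rw [show i - 1 + 1 = i by omega] at this
          exact this.symm
        · exact hadj i hil
        · exact hab
      have h3 := Finset.card_le_card hsub
      rw [Finset.card_insert_of_notMem (by simp [hne, hpb]),
        Finset.card_insert_of_notMem (by simp [hpb]), Finset.card_singleton,
        ← Set.ncard_eq_toFinset_card] at h3
      have := h2 (p.getVert i)
      omega
  -- A chord would be a second path between its ends, next to the segment of `p`; a forest has only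
  -- one.
  have hkey : ∀ i j, i < j → j ≤ p.length → F.Adj (p.getVert i) (p.getVert j) → j = i + 1 := by
    intro i j hij hj hA
    have hq : ((p.drop i).take (j - i)).IsPath := (hp.drop i).take _
    have hend : (p.drop i).getVert (j - i) = p.getVert j := by
      rw [Walk.drop_getVert]; congr 1; omega
    have hl : ((p.drop i).take (j - i)).length = j - i := by
      rw [Walk.take_length, Walk.drop_length]; omega
    have hq' : (((p.drop i).take (j - i)).copy rfl hend).IsPath := by simpa using hq
    have := (ha.subsingleton_path _ _).elim ⟨_, hq'⟩ ⟨_, Walk.IsPath.of_adj hA⟩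
    have := congrArg (fun z => z.1.length) this
    simp [hl] at this
    omega
  refine ⟨p.length, ⟨SimpleGraph.Iso.symm ⟨Equiv.ofBijective (fun i : Fin (p.length + 1) =>
    p.getVert i) ⟨?_, ?_⟩, ?_⟩⟩⟩
  · intro i j hij
    exact Fin.ext (hinj (by simp; omega) (by simp; omega) hij)
  · intro w
    obtain ⟨i, rfl, hi⟩ := Walk.mem_support_iff_exists_getVert.1 (hsupp w)
    exact ⟨⟨i, by omega⟩, rfl⟩
  · intro i j
    change F.Adj (p.getVert i) (p.getVert j) ↔ _
    rw [pathGraph_adj]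
    constructor
    · intro h
      rcases lt_trichotomy (i : ℕ) j with hij | hij | hij
      · left; exact (hkey i j hij (by omega) h).symm
      · rw [hij] at h; exact absurd h (F.loopless.irrefl _)
      · right; exact (hkey j i hij (by omega) h.symm).symm
    · rintro (h | h)
      · rw [← h]; exact hadj _ (by omega)
      · rw [← h]; exact (hadj _ (by omega)).symm

variable {V : Type*} {H : SimpleGraph V}

theorem Subgraph.ncard_neighborSet_coe (Q : H.Subgraph) (v : Q.verts) :
    (Q.coe.neighborSet v).ncard = (Q.neighborSet v).ncard := by
  rw [← Set.ncard_image_of_injective _ Subtype.val_injective]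
  congr 1
  ext w
  simp only [Set.mem_image, mem_neighborSet, Subgraph.coe_adj, Subgraph.mem_neighborSet,
    Subtype.exists, exists_and_right, exists_eq_right]
  exact ⟨fun ⟨_, h⟩ => h, fun h => ⟨Q.edge_vert h.symm, h⟩⟩

theorem ConnectedComponent.ncard_neighborSet_toSimpleGraph {W : Type*} {F : SimpleGraph W}
    (c : F.ConnectedComponent) (v : c.supp) :
    (c.toSimpleGraph.neighborSet v).ncard = (F.neighborSet v).ncard := by
  rw [← Set.ncard_image_of_injective _ Subtype.val_injective]
  congr 1
  ext w
  simp only [Set.mem_image, mem_neighborSet, Subtype.exists, exists_and_right, exists_eq_right]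
  constructor
  · rintro ⟨_, h⟩
    exact h
  · intro h
    exact ⟨c.mem_supp_of_adj_mem_supp v.2 h, h⟩

theorem isLinearForest_of_ncard_neighborSet_le_two [Finite V] {Q : H.Subgraph}
    (ha : Q.coe.IsAcyclic) (h2 : ∀ v ∈ Q.verts, (Q.neighborSet v).ncard ≤ 2) :
    IsLinearForest Q := by
  refine ⟨ha, fun c => isPathGraph_of_ncard_neighborSet_le_two c.connected_toSimpleGraph
    (ha.induce _) fun v => ?_⟩
  rw [ConnectedComponent.ncard_neighborSet_toSimpleGraph c v, Subgraph.ncard_neighborSet_coe]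
  exact h2 _ v.1.2

theorem ncard_neighborSet_iso {V W : Type*} {F : SimpleGraph V} {F' : SimpleGraph W} (e : F ≃g F')
    (v : V) : (F'.neighborSet (e v)).ncard = (F.neighborSet v).ncard := by
  rw [← Set.ncard_image_of_injective (F.neighborSet v) e.injective]
  congr 1
  ext w
  simp only [mem_neighborSet, Set.mem_image]
  constructor
  · intro h
    exact ⟨e.symm w, by rw [← e.map_adj_iff]; simpa using h, by simp⟩
  · rintro ⟨z, hz, rfl⟩
    exact e.map_adj_iff.2 hz

theorem ncard_neighborSet_pathGraph_le_two (k : ℕ) (i : Fin (k + 1)) :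
    ((pathGraph (k + 1)).neighborSet i).ncard ≤ 2 := by
  classical
  have : (Fin.val '' (pathGraph (k + 1)).neighborSet i) ⊆
      (({(i : ℕ) - 1, (i : ℕ) + 1} : Finset ℕ) : Set ℕ) := by
    rintro _ ⟨j, hj, rfl⟩
    rw [mem_neighborSet, pathGraph_adj] at hj
    simp only [Finset.coe_insert, Finset.coe_singleton, Set.mem_insert_iff, Set.mem_singleton_iff]
    omega
  rw [← Set.ncard_image_of_injective _ Fin.val_injective]
  refine (Set.ncard_le_ncard this).trans ?_
  rw [Set.ncard_coe_finset]
  exact Finset.card_le_two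

theorem two_le_ncard_neighborSet_pathGraph (k : ℕ) (i : Fin (k + 1)) (h0 : (i : ℕ) ≠ 0)
    (hk : (i : ℕ) ≠ k) : 2 ≤ ((pathGraph (k + 1)).neighborSet i).ncard := by
  have hsub : ({⟨(i : ℕ) - 1, by omega⟩, ⟨(i : ℕ) + 1, by omega⟩} : Set (Fin (k + 1))) ⊆
      (pathGraph (k + 1)).neighborSet i := by
    intro j hj
    simp only [Set.mem_insert_iff, Set.mem_singleton_iff] at hj
    rw [mem_neighborSet, pathGraph_adj]
    rcases hj with rfl | rfl <;> grind
  refine le_trans ?_ (Set.ncard_le_ncard hsub)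
  rw [Set.ncard_pair]
  intro h
  rw [Fin.mk.injEq] at h
  omega

theorem ncard_neighborSet_pathGraph_zero_le_one (k : ℕ) :
    ((pathGraph (k + 1)).neighborSet 0).ncard ≤ 1 := by
  rw [Set.ncard_le_one]
  intro a ha b hb
  rw [mem_neighborSet, pathGraph_adj] at ha hb
  simp at ha hb
  exact Fin.ext (by omega)

theorem IsPathGraph.ncard_neighborSet_le_two {F : SimpleGraph V} (hF : IsPathGraph F) (v : V) :
    (F.neighborSet v).ncard ≤ 2 := by
  obtain ⟨k, ⟨e⟩⟩ := hF
  rw [← ncard_neighborSet_iso e]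
  exact ncard_neighborSet_pathGraph_le_two _ _

theorem IsPathGraph.exists_ncard_neighborSet_le_one {F : SimpleGraph V} (hF : IsPathGraph F) :
    ∃ v, (F.neighborSet v).ncard ≤ 1 := by
  obtain ⟨k, ⟨e⟩⟩ := hF
  refine ⟨e.symm 0, ?_⟩
  rw [← ncard_neighborSet_iso e]
  simpa using ncard_neighborSet_pathGraph_zero_le_one k

theorem IsPathGraph.exists_pair {F : SimpleGraph V} (hF : IsPathGraph F) :
    ∃ a b : V, ∀ v, (F.neighborSet v).ncard ≤ 1 → v = a ∨ v = b := by
  obtain ⟨k, ⟨e⟩⟩ := hF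
  refine ⟨e.symm 0, e.symm (Fin.last k), fun v hv => ?_⟩
  rw [← ncard_neighborSet_iso e] at hv
  by_contra! h
  have := two_le_ncard_neighborSet_pathGraph k (e v) (fun h0 => h.1 ?_) (fun h0 => h.2 ?_)
  · omega
  · rw [show (0 : Fin (k + 1)) = e v from Fin.ext h0.symm]; simp
  · rw [show Fin.last k = e v from Fin.ext h0.symm]; simp

variable {P : H.Subgraph}

theorem IsLinearForest.ncard_neighborSet_le_two (hP : IsLinearForest P) (v : V) :
    (P.neighborSet v).ncard ≤ 2 := by
  by_cases hv : v ∈ P.verts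
  · rw [← Subgraph.ncard_neighborSet_coe P ⟨v, hv⟩,
      ← ConnectedComponent.ncard_neighborSet_toSimpleGraph (P.coe.connectedComponentMk ⟨v, hv⟩)
        ⟨_, rfl⟩]
    exact (hP.2 _).ncard_neighborSet_le_two _
  · rw [show P.neighborSet v = ∅ from Set.eq_empty_of_forall_notMem fun w hw =>
      hv (P.edge_vert hw)]
    simp

theorem IsLinearForest.ncard_pathEndpoints_le [Finite V] (hP : IsLinearForest P) :
    (pathEndpoints P).ncard ≤ 2 * numPaths P := by
  classical
  have hfin := Fintype.ofFinite P.coe.ConnectedComponent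
  choose a b hab using fun c => (hP.2 c).exists_pair
  have hsub : pathEndpoints P ⊆
      ((Finset.univ.image (fun c => ((a c).1 : V)) ∪ Finset.univ.image (fun c => ((b c).1 : V)) :
        Finset V) : Set V) := by
    rintro v ⟨hv, h1⟩
    rw [← Subgraph.ncard_neighborSet_coe P ⟨v, hv⟩,
      ← ConnectedComponent.ncard_neighborSet_toSimpleGraph (P.coe.connectedComponentMk ⟨v, hv⟩)
        ⟨_, rfl⟩] at h1
    simp only [Finset.coe_union, Finset.coe_image, Finset.coe_univ, Set.image_univ, Set.mem_union,
      Set.mem_range]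
    rcases hab _ _ h1 with h | h
    · left; exact ⟨_, by rw [← h]⟩
    · right; exact ⟨_, by rw [← h]⟩
  refine (Set.ncard_le_ncard hsub).trans ?_
  rw [Set.ncard_coe_finset]
  refine (Finset.card_union_le _ _).trans ?_
  have h1 := Finset.card_image_le (s := Finset.univ) (f := fun c => ((a c).1 : V))
  have h2 := Finset.card_image_le (s := Finset.univ) (f := fun c => ((b c).1 : V))
  rw [numPaths, Nat.card_eq_fintype_card]
  simp only [Finset.card_univ] at h1 h2
  omega

/-- Every component contributes an endpoint of its own. This reduces bounding the number of paths of
the new forest to counting its endpoints. -/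
theorem IsLinearForest.numPaths_le [Finite V] (hP : IsLinearForest P) :
    numPaths P ≤ (pathEndpoints P).ncard := by
  choose a ha using fun c => (hP.2 c).exists_ncard_neighborSet_le_one
  rw [numPaths, ← Nat.card_coe_set_eq]
  refine Nat.card_le_card_of_injective
    (fun c => (⟨(a c).1, (a c).1.2, ?_⟩ : pathEndpoints P)) ?_
  · have := ha c
    rwa [ConnectedComponent.ncard_neighborSet_toSimpleGraph, Subgraph.ncard_neighborSet_coe] at this
  · intro c c' h
    have h0 : ((a c).1 : V) = (a c').1 := congrArg (fun z : pathEndpoints P => (z : V)) h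
    have h' : (a c).1 = (a c').1 := Subtype.ext h0
    have h1 : P.coe.connectedComponentMk (a c).1 = c := (a c).2
    have h2 : P.coe.connectedComponentMk (a c').1 = c' := (a c').2
    rw [← h1, ← h2, h']

/-- Acyclicity is transferred to the full vertex type because edges to vertices outside `P.verts`
are added later. -/
theorem IsLinearForest.isAcyclic_spanningCoe (hP : IsLinearForest P) :
    P.spanningCoe.IsAcyclic := by
  classical
  intro v w hw
  have hs : ∀ z ∈ w.support, z ∈ P.verts := by
    intro z hz
    have h := hw.rotate hz
    have := (w.rotate z hz).adj_snd h.not_nil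
    exact P.edge_vert this
  have hc : (w.induce P.verts hs).IsCycle := by
    rw [← Walk.isCycle_map_iff_of_injective (f := (Embedding.induce (G := P.spanningCoe)
      P.verts).toHom) (Embedding.induce (G := P.spanningCoe) P.verts).injective, Walk.map_induce]
    exact hw
  exact hP.1 _ hc

end LinearForests

/-! ### Raising degrees to two by pendant edges -/

section ForestExtension

open SimpleGraph

variable {V : Type*} {F : SimpleGraph V} {a w : V}

/-- A cycle through the new edge would need an old walk that ends at `w`, but `w` is isolated. -/
theorem isAcyclic_sup_edge_of_isolated (hF : F.IsAcyclic) (haw : a ≠ w)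
    (hw : ∀ z, ¬ F.Adj w z) : (F ⊔ edge a w).IsAcyclic := by
  refine hF.sup_edge_of_not_reachable fun h => ?_
  obtain ⟨q⟩ := h.symm
  cases q with
  | nil => exact haw rfl
  | cons h' _ => exact hw _ h'

theorem deg_sup_edge_left [Finite V] (haw : a ≠ w) (hw : ∀ z, ¬ F.Adj w z) :
    deg (F ⊔ edge a w) a = deg F a + 1 := by
  have : (F ⊔ edge a w).neighborSet a = insert w (F.neighborSet a) := by
    ext z
    simp only [mem_neighborSet, sup_adj, edge_adj, Set.mem_insert_iff]
    grind
  have hn : w ∉ F.neighborSet a := fun h => hw a (SimpleGraph.Adj.symm h)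
  rw [deg, this, Set.ncard_insert_of_notMem hn, deg]

theorem deg_sup_edge_right (haw : a ≠ w) (hw : ∀ z, ¬ F.Adj w z) :
    deg (F ⊔ edge a w) w = 1 := by
  have : (F ⊔ edge a w).neighborSet w = {a} := by
    ext z
    have := hw z
    simp only [mem_neighborSet, sup_adj, edge_adj, Set.mem_singleton_iff]
    grind
  rw [deg, this, Set.ncard_singleton]

theorem deg_sup_edge_of_ne {v : V} (hva : v ≠ a) (hvw : v ≠ w) :
    deg (F ⊔ edge a w) v = deg F v := by
  have : (F ⊔ edge a w).neighborSet v = F.neighborSet v := by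
    ext z
    simp only [mem_neighborSet, sup_adj, edge_adj]
    grind
  rw [deg, this, deg]

theorem deg_eq_zero_of_isolated {F : SimpleGraph V} (hw : ∀ z, ¬ F.Adj w z) : deg F w = 0 := by
  rw [deg, show F.neighborSet w = ∅ from Set.eq_empty_of_forall_notMem hw, Set.ncard_empty]

/-- A vertex of a linear forest can be brought to degree two by joining it to isolated vertices. -/
theorem exists_extension_vertex [Finite V] (hF : F.IsAcyclic) (h2 : ∀ v, deg F v ≤ 2) (a : V)
    (g : Fin 2 → V) (hg : Function.Injective g) (hga : ∀ j, g j ≠ a)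
    (hiso : ∀ j z, ¬ F.Adj (g j) z) :
    ∃ F' : SimpleGraph V, F ≤ F' ∧ F'.IsAcyclic ∧
      (∀ v z, F'.Adj v z → F.Adj v z ∨ ∃ j, (v = a ∧ z = g j) ∨ (z = a ∧ v = g j)) ∧
      deg F' a = 2 ∧ (∀ j, deg F' (g j) ≤ 1) ∧
      ∀ v, v ≠ a → (∀ j, v ≠ g j) → deg F' v = deg F v := by
  have h01 : g 0 ≠ g 1 := fun h => by simpa using hg h
  have hga0 := (hga 0).symm
  have hga1 := (hga 1).symm
  have hadj : ∀ (F : SimpleGraph V) (w v z : V), (F ⊔ edge a w).Adj v z →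
      F.Adj v z ∨ (v = a ∧ z = w) ∨ (z = a ∧ v = w) := by
    intro F w v z h
    simp only [sup_adj, edge_adj] at h
    grind
  have h2a := h2 a
  have hz : ∀ j, deg F (g j) = 0 := fun j => deg_eq_zero_of_isolated (hiso j)
  -- Only as many targets are used as are missing: both, `g 0` alone, or none. Degree one occurs for
  -- ends of old paths and for vertices that have already served as a target.
  have hcase : deg F a = 0 ∨ deg F a = 1 ∨ deg F a = 2 := by omega
  rcases hcase with h | h | h
  · have hiso1 : ∀ z, ¬ (F ⊔ edge a (g 0)).Adj (g 1) z := by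
      intro z hA
      rcases hadj _ _ _ _ hA with hA | hA | hA
      · exact hiso 1 z hA
      · exact hga1 hA.1.symm
      · exact h01 hA.2.symm
    refine ⟨F ⊔ edge a (g 0) ⊔ edge a (g 1), le_sup_left.trans le_sup_left,
      isAcyclic_sup_edge_of_isolated (isAcyclic_sup_edge_of_isolated hF hga0 (hiso 0)) hga1 hiso1,
      ?_, ?_, ?_, ?_⟩
    · intro v z hA
      rcases hadj _ _ _ _ hA with hA | hA
      · rcases hadj _ _ _ _ hA with hA | hA
        · exact Or.inl hA
        · exact Or.inr ⟨0, hA⟩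
      · exact Or.inr ⟨1, hA⟩
    · rw [deg_sup_edge_left hga1 hiso1, deg_sup_edge_left hga0 (hiso 0), h]
    · intro j
      fin_cases j
      · change deg _ (g 0) ≤ 1
        rw [deg_sup_edge_of_ne hga0.symm h01, deg_sup_edge_right hga0 (hiso 0)]
      · change deg _ (g 1) ≤ 1
        rw [deg_sup_edge_right hga1 hiso1]
    · intro v hv hvg
      rw [deg_sup_edge_of_ne hv (hvg 1), deg_sup_edge_of_ne hv (hvg 0)]
  · refine ⟨F ⊔ edge a (g 0), le_sup_left, isAcyclic_sup_edge_of_isolated hF hga0 (hiso 0),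
      ?_, ?_, ?_, ?_⟩
    · intro v z hA
      rcases hadj _ _ _ _ hA with hA | hA
      · exact Or.inl hA
      · exact Or.inr ⟨0, hA⟩
    · rw [deg_sup_edge_left hga0 (hiso 0), h]
    · intro j
      fin_cases j
      · change deg _ (g 0) ≤ 1
        rw [deg_sup_edge_right hga0 (hiso 0)]
      · change deg _ (g 1) ≤ 1
        rw [deg_sup_edge_of_ne hga1.symm h01.symm, hz]
        omega
    · intro v hv hvg
      rw [deg_sup_edge_of_ne hv (hvg 0)]
  · exact ⟨F, le_rfl, hF, fun v z hA => Or.inl hA, h, fun j => by rw [hz]; omega,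
      fun _ _ _ => rfl⟩

/-- The vertices of `A` can all be brought to degree two in a linear forest by joining each of
them to private isolated vertices, provided that no vertex is used after it was processed. -/
theorem exists_forest_extension [Finite V] (ρ : V → ℕ) (g : V → Fin 2 → V) (A : Finset V) :
    ∀ F : SimpleGraph V, F.IsAcyclic → (∀ v, deg F v ≤ 2) →
      (∀ a ∈ A, ∀ j z, ¬ F.Adj (g a j) z) →
      (∀ a ∈ A, ∀ b ∈ A, ∀ i j, g a i = g b j → a = b ∧ i = j) →
      (∀ a ∈ A, ∀ j, g a j ∈ A → ρ a < ρ (g a j)) →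
      ∃ F' : SimpleGraph V, F ≤ F' ∧ F'.IsAcyclic ∧
        (∀ v z, F'.Adj v z → F.Adj v z ∨
          ∃ a ∈ A, ∃ j, (v = a ∧ z = g a j) ∨ (z = a ∧ v = g a j)) ∧
        (∀ a ∈ A, deg F' a = 2) ∧
        (∀ v, v ∉ A → (∃ a ∈ A, ∃ j, v = g a j) → deg F' v ≤ 1) ∧
        (∀ v, v ∉ A → (∀ a ∈ A, ∀ j, v ≠ g a j) → deg F' v = deg F v) := by
  classical
  -- The vertex of least rank is treated first. A target lying in `A` has larger rank, so it is
  -- still untreated and isolated when it is used, and later receives its own missing edges.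
  induction A using Finset.induction_on_min_value ρ with
  | empty => exact fun F hF _ _ _ _ => ⟨F, le_rfl, hF, fun v z h => Or.inl h, by simp, by simp,
      by simp⟩
  | insert a s has hmin ih =>
    intro F hF h2 hiso hinj hrank
    have ha := Finset.mem_insert_self a s
    have hs : ∀ b ∈ s, b ∈ insert a s := fun b hb => Finset.mem_insert_of_mem hb
    have hga : ∀ j, g a j ≠ a := fun j h => by
      have := hrank a ha j (by rw [h]; exact ha)
      rw [h] at this
      exact lt_irrefl _ this
    have hgb : ∀ b ∈ s, ∀ j, g b j ≠ a := fun b hb j h => by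
      have := hrank b (hs b hb) j (by rw [h]; exact ha)
      rw [h] at this
      exact absurd (hmin b hb) (by omega)
    obtain ⟨F₁, hle, hac, hadj, hdega, hdegg, hdego⟩ := exists_extension_vertex hF h2 a (g a)
      (fun i j h => (hinj a ha a ha i j h).2) hga (hiso a ha)
    obtain ⟨F₂, hle₂, hac₂, hadj₂, hdega₂, hdegg₂, hdego₂⟩ := ih F₁ hac
      (fun v => by
        by_cases hv : v = a
        · rw [hv, hdega]
        · by_cases hv' : ∃ j, v = g a j
          · obtain ⟨j, rfl⟩ := hv'
            exact (hdegg j).trans (by omega)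
          · push Not at hv'
            rw [hdego v hv hv']
            exact h2 v)
      (fun b hb j z hA => by
        rcases hadj _ _ hA with hA | ⟨i, hA | hA⟩
        · exact hiso b (hs b hb) j z hA
        · exact hgb b hb j hA.1
        · obtain rfl := (hinj b (hs b hb) a ha j i hA.2).1
          exact has hb)
      (fun b hb c hc => hinj b (hs b hb) c (hs c hc))
      (fun b hb j h => hrank b (hs b hb) j (hs _ h))
    have hnot : ∀ i, ∀ b ∈ s, ∀ j, g a i ≠ g b j := fun i b hb j h => by
      obtain rfl := (hinj a ha b (hs b hb) i j h).1
      exact has hb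
    refine ⟨F₂, hle.trans hle₂, hac₂, ?_, ?_, ?_, ?_⟩
    · intro v z hA
      rcases hadj₂ v z hA with hA | ⟨b, hb, j, h⟩
      · rcases hadj v z hA with hA | ⟨j, h⟩
        · exact Or.inl hA
        · exact Or.inr ⟨a, ha, j, h⟩
      · exact Or.inr ⟨b, hs b hb, j, h⟩
    · intro b hb
      rcases Finset.mem_insert.1 hb with rfl | hb
      · rw [hdego₂ _ has (fun c hc j h => hgb c hc j h.symm), hdega]
      · exact hdega₂ b hb
    · rintro v hv ⟨b, hb, j, rfl⟩
      rcases Finset.mem_insert.1 hb with rfl | hb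
      · rw [hdego₂ _ (fun h => hv (hs _ h)) (hnot j)]
        exact hdegg j
      · exact hdegg₂ _ (fun h => hv (hs _ h)) ⟨b, hb, j, rfl⟩
    · intro v hv hv'
      rw [hdego₂ v (fun h => hv (hs _ h)) (fun b hb j => hv' b (hs b hb) j),
        hdego v (fun h => hv (h ▸ ha)) (fun j => hv' a ha j)]

end ForestExtension

/-! ### Consequences of local sparsity: closure, degenerate ordering, private neighbours -/

section SparseSets

variable {V : Type*}

open Classical in
/-- The number of neighbours of `v` in the finite set `A`. -/
noncomputable def degIn (F : SimpleGraph V) (v : V) (A : Finset V) : ℕ :=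
  (A.filter (F.Adj v)).card

theorem degInto_coe (F : SimpleGraph V) (v : V) (A : Finset V) :
    degInto F v (A : Set V) = degIn F v A := by
  classical
  rw [degInto, degIn, ← Set.ncard_coe_finset]
  congr 1
  ext w
  simp [and_comm]

theorem deg_eq_degIn_univ [Fintype V] (F : SimpleGraph V) (v : V) :
    deg F v = degIn F v Finset.univ := by
  rw [← degInto_coe, degInto, deg, Finset.coe_univ, Set.inter_univ]

theorem degIn_mono {F : SimpleGraph V} {v : V} {A B : Finset V} (h : A ⊆ B) :
    degIn F v A ≤ degIn F v B := by
  classical exact Finset.card_le_card (Finset.filter_subset_filter _ h)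

theorem degIn_mono_left {F F' : SimpleGraph V} {v : V} {A : Finset V} (h : F ≤ F') :
    degIn F v A ≤ degIn F' v A := by
  classical exact Finset.card_le_card (Finset.monotone_filter_right _ fun _ _ hw => h hw)

theorem degIn_union_le [DecidableEq V] {F : SimpleGraph V} {v : V} {A B : Finset V} :
    degIn F v (A ∪ B) ≤ degIn F v A + degIn F v B := by
  classical
  unfold degIn
  rw [Finset.filter_union]
  exact Finset.card_union_le _ _

theorem degIn_union_disjoint [DecidableEq V] {F : SimpleGraph V} {v : V} {A B : Finset V}
    (h : Disjoint A B) : degIn F v (A ∪ B) = degIn F v A + degIn F v B := by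
  classical
  unfold degIn
  rw [Finset.filter_union,
    Finset.card_union_of_disjoint (Finset.disjoint_filter_filter h)]

theorem degIn_sdiff_ge [DecidableEq V] {F : SimpleGraph V} {v : V} {A B : Finset V} :
    degIn F v A ≤ degIn F v (A \ B) + degIn F v B :=
  (degIn_mono (by intro z hz; by_cases z ∈ B <;> simp_all)).trans degIn_union_le

/-- Every vertex set of size at most `m` spans few edges: the degrees inside `A` add up to at most
`x * |A|`. -/
def LocallySparse (F : SimpleGraph V) (m x : ℝ) : Prop :=
  ∀ A : Finset V, (A.card : ℝ) ≤ m → ((∑ v ∈ A, degIn F v A : ℕ) : ℝ) ≤ x * A.card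

theorem LocallySparse.anti {F F' : SimpleGraph V} {m x : ℝ} (h : LocallySparse F' m x)
    (hF : F ≤ F') : LocallySparse F m x := fun A hA =>
  le_trans (by exact_mod_cast Finset.sum_le_sum fun v _ => degIn_mono_left hF) (h A hA)

variable {F : SimpleGraph V} {m x : ℝ}

/-- A small set can be enlarged so that no outside vertex has many neighbours in it. -/
theorem LocallySparse.exists_closure [Fintype V] [DecidableEq V] (hF : LocallySparse F m x)
    (hx : 0 < x) (C : Finset V) (hC : 2 * (C.card : ℝ) ≤ m) :
    ∃ B : Finset V, C ⊆ B ∧ B.card ≤ 2 * C.card ∧ ∀ v ∉ B, (degIn F v B : ℝ) ≤ 3 * x := by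
  classical
  -- Instead of adding vertices one at a time, take a largest set whose degree sum certifies that
  -- each added vertex brought at least 3x.
  have hne : (Finset.univ.filter fun A : Finset V => C ⊆ A ∧ A.card ≤ 2 * C.card ∧
      3 * x * ((A.card : ℝ) - C.card) ≤ ((∑ v ∈ A, degIn F v A : ℕ) : ℝ)).Nonempty :=
    ⟨C, by simp; exact ⟨by omega, by exact_mod_cast Nat.zero_le _⟩⟩
  obtain ⟨B, hB, hmax⟩ := Finset.exists_max_image _ Finset.card hne
  simp only [Finset.mem_filter, Finset.mem_univ, true_and] at hB hmax
  obtain ⟨hCB, hcard, hsum⟩ := hB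
  refine ⟨B, hCB, hcard, fun v hv => ?_⟩
  by_contra! hlt
  have hstep : ((degIn F v B + ∑ w ∈ B, degIn F w B : ℕ) : ℝ) ≤
      ((∑ w ∈ insert v B, degIn F w (insert v B) : ℕ) : ℝ) := by
    rw [Finset.sum_insert hv]
    exact_mod_cast add_le_add (degIn_mono (Finset.subset_insert _ _))
      (Finset.sum_le_sum fun w _ => degIn_mono (Finset.subset_insert _ _))
  push_cast at hstep
  push_cast at hsum
  -- At size 2|C| the certified degree sum 3x|C| exceeds the permitted 2x|C| unless C is empty.
  -- Below that size, `v` could be added, against maximality.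
  rcases hcard.eq_or_lt with h | h
  · have h1 := hF B (by rw [h]; push_cast; exact hC)
    push_cast at h1
    have h2 : (B.card : ℝ) = 2 * C.card := by exact_mod_cast h
    have h3 : (C.card : ℝ) ≤ 0 := by
      by_contra! h3
      nlinarith
    have h4 : B = ∅ := by
      rw [← Finset.card_eq_zero]
      have : (B.card : ℝ) ≤ 0 := by linarith
      exact_mod_cast le_antisymm this (Nat.cast_nonneg _)
    rw [h4] at hlt
    simp [degIn] at hlt
    linarith
  · have hc : (insert v B).card = B.card + 1 := Finset.card_insert_of_notMem hv
    have := hmax (insert v B) ⟨hCB.trans (Finset.subset_insert _ _), by omega, by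
      push_cast [hc]
      linarith⟩
    omega

/-- A small set can be ordered so that no vertex has many neighbours among its predecessors. -/
theorem LocallySparse.exists_ordering [DecidableEq V] (hF : LocallySparse F m x) :
    ∀ B : Finset V, (B.card : ℝ) ≤ m → ∃ ρ : V → ℕ, (∀ b ∈ B, ρ b < B.card) ∧
      ∀ b ∈ B, (degIn F b (B.filter fun b' => ρ b' ≤ ρ b) : ℝ) ≤ x := by
  classical
  intro B
  induction hn : B.card generalizing B with
  | zero =>
    intro _
    rw [Finset.card_eq_zero] at hn
    subst hn
    exact ⟨fun _ => 0, by simp, by simp⟩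
  | succ k ih =>
    intro hm
    have hBne : B.Nonempty := Finset.card_pos.1 (by omega)
    -- Some vertex has at most the average inner degree; it receives the last rank and the rest is
    -- ordered inductively.
    obtain ⟨b, hb, hbx⟩ : ∃ b ∈ B, (degIn F b B : ℝ) ≤ x := by
      by_contra! h
      have h1 := hF B (by rw [hn]; exact hm)
      have h2 := Finset.sum_lt_sum_of_nonempty hBne h
      push_cast at h1
      rw [Finset.sum_const, nsmul_eq_mul] at h2
      linarith
    have hc : (B.erase b).card = k := by rw [Finset.card_erase_of_mem hb]; omega
    obtain ⟨ρ, hρ, hρ'⟩ := ih (B.erase b) hc (le_trans (by push_cast; linarith) hm)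
    refine ⟨Function.update ρ b k, fun c hc' => ?_, fun c hc' => ?_⟩
    · by_cases h : c = b
      · subst h; simp
      · rw [Function.update_of_ne h]
        have := hρ c (Finset.mem_erase.2 ⟨h, hc'⟩)
        omega
    · by_cases h : c = b
      · subst h
        exact le_trans (by exact_mod_cast degIn_mono (Finset.filter_subset _ _)) hbx
      · have hcm := Finset.mem_erase.2 ⟨h, hc'⟩
        refine le_trans ?_ (hρ' c hcm)
        have := hρ c hcm
        norm_cast
        refine degIn_mono fun z hz => ?_
        rw [Finset.mem_filter, Function.update_of_ne h] at hz
        by_cases hzb : z = b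
        · subst hzb
          simp at hz
          omega
        · rw [Function.update_of_ne hzb] at hz
          exact Finset.mem_filter.2 ⟨Finset.mem_erase.2 ⟨hzb, hz.1⟩, hz.2⟩

/-- The vertices of a small set can be given two private neighbours each, if they all have
sufficiently many neighbours to choose from. -/
theorem LocallySparse.exists_private_neighbors [DecidableEq V] (hF : LocallySparse F m x)
    (X : Finset V) (hX : 3 * (X.card : ℝ) ≤ m) (N : V → Finset V)
    (hN : ∀ v ∈ X, ∀ w ∈ N v, F.Adj v w) (hx : 0 < x)
    (hcard : ∀ v ∈ X, 3 * x < ((N v).card : ℝ)) :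
    ∃ g : V → Fin 2 → V, (∀ v ∈ X, ∀ j, g v j ∈ N v) ∧
      ∀ v ∈ X, ∀ w ∈ X, ∀ i j, g v i = g w j → v = w ∧ i = j := by
  classical
  -- Hall's theorem with two copies of each vertex. A violating family on vertices Y has all its
  -- candidates in Z with |Z| < 2|Y|, so Y ∪ Z has at most 3|Y| vertices while Y alone contributes
  -- more than 3x|Y| to its degree sum.
  obtain ⟨f, hinj, hf⟩ := (Finset.all_card_le_biUnion_card_iff_exists_injective
    (fun q : X × Fin 2 => N q.1)).1 (by
      intro s
      by_contra! hlt
      let Y : Finset V := s.image fun q => (q.1 : V)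
      have hYX : Y ⊆ X := by
        intro y hy
        obtain ⟨q, -, rfl⟩ := Finset.mem_image.1 hy
        exact q.1.2
      have hsY : s.card ≤ 2 * Y.card := by
        have : s.card ≤ (Y ×ˢ (Finset.univ : Finset (Fin 2))).card := by
          refine Finset.card_le_card_of_injOn (fun q => ((q.1 : V), q.2)) ?_ ?_
          · intro q hq
            simp only [Finset.coe_product, Set.mem_prod, Finset.mem_coe, Finset.mem_univ, and_true]
            exact Finset.mem_image_of_mem _ hq
          · intro q _ q' _ h
            simp only [Prod.mk.injEq] at h
            exact Prod.ext (Subtype.ext h.1) h.2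
        rw [Finset.card_product, Finset.card_univ, Fintype.card_fin] at this
        omega
      let Z := s.biUnion fun q => N q.1
      have hZ : Z.card < 2 * Y.card := lt_of_lt_of_le hlt hsY
      have hYZ : (Y ∪ Z).card < 3 * Y.card + 0 := by
        have := Finset.card_union_le Y Z
        omega
      have hsize : ((Y ∪ Z).card : ℝ) ≤ 3 * Y.card := by exact_mod_cast hYZ.le
      have hYX' : (Y.card : ℝ) ≤ X.card := by exact_mod_cast Finset.card_le_card hYX
      have h1 := hF (Y ∪ Z) (by linarith)
      have h2 : ∑ v ∈ Y, (3 * x) < ∑ v ∈ Y, (degIn F v (Y ∪ Z) : ℝ) := by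
        have hYne : Y.Nonempty := Finset.card_pos.1 (by omega)
        refine Finset.sum_lt_sum_of_nonempty hYne fun v hv => ?_
        obtain ⟨q, hq, rfl⟩ := Finset.mem_image.1 hv
        refine lt_of_lt_of_le (hcard _ q.1.2) ?_
        norm_cast
        refine Finset.card_le_card fun w hw => ?_
        exact Finset.mem_filter.2 ⟨Finset.mem_union_right _ (Finset.mem_biUnion.2 ⟨q, hq, hw⟩),
          hN _ q.1.2 w hw⟩
      have h3 : ∑ v ∈ Y, (degIn F v (Y ∪ Z) : ℝ) ≤ ∑ v ∈ Y ∪ Z, (degIn F v (Y ∪ Z) : ℝ) :=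
        Finset.sum_le_sum_of_subset_of_nonneg Finset.subset_union_left
          fun _ _ _ => Nat.cast_nonneg _
      push_cast at h1
      rw [Finset.sum_const, nsmul_eq_mul] at h2
      nlinarith)
  refine ⟨fun v j => if hv : v ∈ X then f (⟨v, hv⟩, j) else v, ?_, ?_⟩
  · intro v hv j
    simp only [hv, dif_pos]
    exact hf (⟨v, hv⟩, j)
  · intro v hv w hw i j h
    simp only [hv, hw, dif_pos] at h
    have := hinj h
    simp only [Prod.mk.injEq, Subtype.mk.injEq] at this
    exact this

end SparseSets

/-! ### The local lemma and a sparse transversal -/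

section LocalLemma

open scoped Classical in
/-- Events that depend on disjoint sets of coordinates are independent. -/
theorem card_filter_and_mul_card {V α : Type*} [Fintype V] [Fintype α] (S : Finset V)
    (E G : (V → α) → Prop) (hE : ∀ f g : V → α, (∀ v ∈ S, f v = g v) → (E f ↔ E g))
    (hG : ∀ f g : V → α, (∀ v ∉ S, f v = g v) → (G f ↔ G g)) :
    (Finset.univ.filter fun f => E f ∧ G f).card * Fintype.card (V → α) =
      (Finset.univ.filter E).card * (Finset.univ.filter G).card := by
  rw [← Finset.card_univ, ← Finset.card_product, ← Finset.card_product]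
  -- Exchanging the coordinates outside `S` between two samples is an involution that turns (E and
  -- G, anything) into (E, G).
  let σ : (V → α) × (V → α) → (V → α) × (V → α) := fun q =>
    (fun v => if v ∈ S then q.1 v else q.2 v, fun v => if v ∈ S then q.2 v else q.1 v)
  have hσ : ∀ q, σ (σ q) = q := by
    intro q
    refine Prod.ext (funext fun v => ?_) (funext fun v => ?_) <;> simp only [σ] <;> split_ifs <;> rfl
  have h1 : ∀ q : (V → α) × (V → α), E (σ q).1 ↔ E q.1 := fun q =>
    hE _ _ fun v hv => by simp [σ, hv]
  have h2 : ∀ q : (V → α) × (V → α), G (σ q).2 ↔ G q.1 := fun q =>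
    hG _ _ fun v hv => by simp [σ, hv]
  refine Finset.card_nbij' σ σ ?_ ?_ (fun q _ => hσ q) (fun q _ => hσ q)
  · intro q hq
    simp only [Finset.coe_product, Finset.coe_filter, Finset.mem_univ, true_and, Finset.coe_univ,
      Set.mem_prod, Set.mem_ofPred_eq, Set.mem_univ, and_true] at hq ⊢
    exact ⟨(h1 q).2 hq.1, (h2 q).2 hq.2⟩
  · intro q hq
    simp only [Finset.coe_product, Finset.coe_filter, Finset.mem_univ, true_and, Finset.coe_univ,
      Set.mem_prod, Set.mem_ofPred_eq, Set.mem_univ, and_true] at hq ⊢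
    refine ⟨(h1 q).2 hq.1, ?_⟩
    have := h2 (σ q)
    rw [hσ] at this
    exact this.1 hq.2

open scoped Classical in
/-- The symmetric Lovász local lemma for finite product spaces. -/
theorem exists_forall_not_of_local {V α : Type*} [Fintype V] [Fintype α] [Nonempty α]
    (E : V → (V → α) → Prop) (N : V → Finset V)
    (hE : ∀ v, ∀ f g : V → α, (∀ w ∈ N v, f w = g w) → (E v f ↔ E v g)) (q d : ℝ)
    (hq : ∀ v, ((Finset.univ.filter (E v)).card : ℝ) ≤ q * Fintype.card (V → α))
    (hd : ∀ v, ((Finset.univ.filter fun w => ¬ Disjoint (N v) (N w)).card : ℝ) ≤ d)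
    (hq0 : 0 ≤ q) (hqd : 4 * q * d ≤ 1) (hq1 : 2 * q < 1) : ∃ f, ∀ v, ¬ E v f := by
  have hΩ : (0 : ℝ) < Fintype.card (V → α) := by exact_mod_cast Fintype.card_pos
  let good : Finset V → Finset (V → α) := fun S => Finset.univ.filter fun f => ∀ v ∈ S, ¬ E v f
  let bad : V → Finset V → Finset (V → α) := fun v S =>
    Finset.univ.filter fun f => E v f ∧ ∀ w ∈ S, ¬ E w f
  -- The usual induction: conditioned on avoiding the events in `S`, each event has probability at
  -- most 2q.
  have key : ∀ S : Finset V, ∀ v, ((bad v S).card : ℝ) ≤ 2 * q * (good S).card := by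
    intro S
    induction S using Finset.strongInduction with
    | H S ih =>
      intro v
      let S₂ := S.filter fun w => Disjoint (N v) (N w)
      have hind : ((bad v S₂).card : ℝ) ≤ q * (good S₂).card := by
        have h := card_filter_and_mul_card (N v) (E v) (fun f => ∀ w ∈ S₂, ¬ E w f) (hE v) (by
          intro f g hfg
          refine forall₂_congr fun w hw => not_congr (hE w f g fun z hz => hfg z fun hz' => ?_)
          exact Finset.disjoint_left.1 (Finset.mem_filter.1 hw).2 hz' hz)
        have h' : ((bad v S₂).card : ℝ) * Fintype.card (V → α) =
            (Finset.univ.filter (E v)).card * (good S₂).card := by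
          rw [← Nat.cast_mul, ← Nat.cast_mul]
          refine congrArg Nat.cast ?_
          convert h
        have := mul_le_mul_of_nonneg_right (hq v) (Nat.cast_nonneg (α := ℝ) (good S₂).card)
        rw [← h'] at this
        have h3 : ((bad v S₂).card : ℝ) * Fintype.card (V → α) ≤
            (q * (good S₂).card) * Fintype.card (V → α) := by linarith
        exact le_of_mul_le_mul_right h3 hΩ
      by_cases hS : S₂ = S
      · rw [hS] at hind
        have := mul_nonneg hq0 (Nat.cast_nonneg (α := ℝ) (good S).card)
        linarith
      · have hlt : S₂ ⊂ S := lt_of_le_of_ne (Finset.filter_subset _ _) hS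
        have hsub : good S₂ ⊆ good S ∪ (S \ S₂).biUnion fun w => bad w S₂ := by
          intro f hf
          simp only [good, bad, Finset.mem_union, Finset.mem_biUnion, Finset.mem_filter,
            Finset.mem_univ, true_and] at hf ⊢
          by_cases h : ∀ w ∈ S, ¬ E w f
          · exact Or.inl h
          · push Not at h
            obtain ⟨w, hw, hwf⟩ := h
            exact Or.inr ⟨w, Finset.mem_sdiff.2 ⟨hw, fun hw' => hf w hw' hwf⟩, hwf, hf⟩
        have hcard : ((good S₂).card : ℝ) ≤
            (good S).card + ∑ w ∈ S \ S₂, ((bad w S₂).card : ℝ) := by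
          have := (Finset.card_le_card hsub).trans ((Finset.card_union_le _ _).trans
            (Nat.add_le_add_left Finset.card_biUnion_le _))
          exact_mod_cast this
        have hsum : ∑ w ∈ S \ S₂, ((bad w S₂).card : ℝ) ≤ d * (2 * q * (good S₂).card) := by
          refine (Finset.sum_le_sum fun w _ => ih S₂ hlt w).trans ?_
          rw [Finset.sum_const, nsmul_eq_mul]
          refine mul_le_mul_of_nonneg_right (le_trans ?_ (hd v)) (by positivity)
          norm_cast
          refine Finset.card_le_card fun w hw => ?_
          simp only [S₂, Finset.mem_sdiff, Finset.mem_filter, not_and] at hw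
          exact Finset.mem_filter.2 ⟨Finset.mem_univ _, hw.2 hw.1⟩
        have hbad : ((bad v S).card : ℝ) ≤ (bad v S₂).card := by
          norm_cast
          refine Finset.card_le_card fun f hf => ?_
          simp only [bad, Finset.mem_filter, Finset.mem_univ, true_and] at hf ⊢
          exact ⟨hf.1, fun w hw => hf.2 w (hlt.1 hw)⟩
        have hg := Nat.cast_nonneg (α := ℝ) (good S₂).card
        -- At most d dependent events, each removing a share of at most 2q, remove at most half
        -- since 4qd ≤ 1.
        have : (good S₂).card ≤ 2 * ((good S).card : ℝ) := by
          nlinarith [mul_le_mul_of_nonneg_right hqd hg]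
        nlinarith
  have hpos : ∀ S : Finset V, 0 < (good S).card := by
    intro S
    induction S using Finset.induction_on with
    | empty => exact Finset.card_pos.2 ⟨fun _ => Classical.arbitrary α, by simp [good]⟩
    | insert v S hv ih =>
      have hsub : good S ⊆ good (insert v S) ∪ bad v S := by
        intro f hf
        simp only [good, bad, Finset.mem_union, Finset.mem_filter, Finset.mem_univ, true_and,
          Finset.forall_mem_insert] at hf ⊢
        by_cases h : E v f
        · exact Or.inr ⟨h, hf⟩
        · exact Or.inl ⟨h, hf⟩
      have h1 : ((good S).card : ℝ) ≤ (good (insert v S)).card + (bad v S).card := by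
        exact_mod_cast (Finset.card_le_card hsub).trans (Finset.card_union_le _ _)
      have h2 := key S v
      have h3 : (0 : ℝ) < (good S).card := by exact_mod_cast ih
      have : (0 : ℝ) < (good (insert v S)).card := by nlinarith
      exact_mod_cast this
  obtain ⟨f, hf⟩ := Finset.card_pos.1 (hpos Finset.univ)
  exact ⟨f, fun v => (Finset.mem_filter.1 hf).2 v (Finset.mem_univ v)⟩

open scoped Classical in
/-- Exponential tail bound for the size of a colour class of a random colouring inside `A`. -/
theorem card_filter_color_class_le {V : Type*} [Fintype V] (m : ℕ) [NeZero m] (A : Finset V)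
    (l t : ℝ) :
    ((Finset.univ.filter fun f : V → Fin m =>
      t ≤ l * (A.filter fun w => f w = 0).card).card : ℝ) ≤
      Real.exp (-t + A.card * ((Real.exp l - 1) / m)) * Fintype.card (V → Fin m) := by
  have hm : (0 : ℝ) < m := by exact_mod_cast Nat.pos_of_ne_zero (NeZero.ne m)
  -- The moment generating function factorises over vertices, with factors of mean 1 + (e^l - 1)/m
  -- on `A`.
  let w : V → Fin m → ℝ := fun v c => if v ∈ A ∧ c = 0 then Real.exp l else 1
  have hw : ∀ f : V → Fin m, ∏ v, w v (f v) =
      Real.exp (l * (A.filter fun w => f w = 0).card) := by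
    intro f
    rw [mul_comm, Real.exp_nat_mul]
    rw [Finset.prod_ite]
    simp only [Finset.prod_const, one_pow, mul_one]
    congr 2
    ext v
    simp
  have hsum : ∑ f : V → Fin m, ∏ v, w v (f v) = ∏ v, ∑ c, w v c := by
    rw [Finset.prod_univ_sum, Fintype.piFinset_univ]
  have hfac : ∀ v, ∑ c, w v c ≤
      m * Real.exp (if v ∈ A then (Real.exp l - 1) / m else 0) := by
    intro v
    by_cases hv : v ∈ A
    · simp only [w, hv, true_and, if_true]
      rw [Finset.sum_ite, Finset.filter_eq']
      simp only [Finset.mem_univ, if_true, Finset.sum_const, Finset.card_singleton, one_smul,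
        nsmul_eq_mul, mul_one]
      have : (Finset.univ.filter fun c : Fin m => ¬ c = 0).card = m - 1 := by
        rw [Finset.filter_not, Finset.filter_eq', if_pos (Finset.mem_univ _),
          Finset.card_sdiff_of_subset (Finset.subset_univ _)]
        simp
      rw [this, Nat.cast_sub (Nat.pos_of_ne_zero (NeZero.ne m))]
      have h1 := Real.add_one_le_exp ((Real.exp l - 1) / m)
      have h2 := mul_le_mul_of_nonneg_left h1 hm.le
      rw [mul_add, mul_div_cancel₀ _ hm.ne'] at h2
      push_cast
      linarith
    · simp [w, hv]
  have htot : ∑ f : V → Fin m, ∏ v, w v (f v) ≤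
      Real.exp (A.card * ((Real.exp l - 1) / m)) * Fintype.card (V → Fin m) := by
    rw [hsum]
    refine (Finset.prod_le_prod (fun v _ => Finset.sum_nonneg fun c _ => ?_)
      fun v _ => hfac v).trans ?_
    · simp only [w]; split_ifs <;> positivity
    · rw [Finset.prod_mul_distrib, Finset.prod_const, ← Real.exp_sum, Finset.sum_ite_mem,
        Finset.univ_inter, Finset.sum_const, nsmul_eq_mul, mul_comm]
      simp
  rw [Real.exp_add, mul_assoc, Real.exp_neg, inv_mul_eq_div, le_div_iff₀ (Real.exp_pos _)]
  refine le_trans ?_ htot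
  rw [← nsmul_eq_mul, ← Finset.sum_const]
  refine (Finset.sum_le_sum (fun f hf => ?_)).trans
    (Finset.sum_le_univ_sum_of_nonneg fun f => ?_)
  · rw [hw]
    exact Real.exp_le_exp.2 (Finset.mem_filter.1 hf).2
  · rw [hw]; positivity

open scoped Classical in
/-- In a graph of bounded degree there is a sparse vertex set that meets every neighbourhood in
few vertices, but still contains some vertices of each large neighbourhood in `U`. -/
theorem eventually_exists_sparse_transversal :
    ∀ᶠ x : ℝ in atTop, ∀ (V : Type) [Fintype V] (H : SimpleGraph V) (U : Finset V),
      (∀ v, (degIn H v Finset.univ : ℝ) ≤ 40 * x ^ 20) →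
      ∃ R : Finset V, (∀ v, (degIn H v R : ℝ) ≤ x ^ 4) ∧
        ∀ v, x ^ 20 / 20000 ≤ (degIn H v U : ℝ) → 3 * x < (degIn H v (R ∩ U) : ℝ) := by
  have hlim := Real.tendsto_pow_mul_exp_neg_atTop_nhds_zero 40
  -- The local lemma condition will read 4 · 2e^(-x) · 1600x^40 ≤ 1, and 4 · 2 · 1600 = 12800.
  have h0 := hlim.eventually (gt_mem_nhds (show (0 : ℝ) < 1 / 12800 by norm_num))
  filter_upwards [h0, eventually_ge_atTop 1000] with x hx0 hx V _ H U hdeg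
  have hx1 : (0 : ℝ) < x := by linarith
  -- One colour class out of about x^17 has mean degree at most 40x^3, well below x^4. A
  -- neighbourhood with x^20/20000 vertices in `U` still meets it in at least x^3/40000 expected
  -- vertices, well above 3x.
  obtain ⟨m, hm⟩ : ∃ m : ℕ, m = ⌈x ^ 17⌉₊ := ⟨_, rfl⟩
  have hx17 : (1 : ℝ) ≤ x ^ 17 := one_le_pow₀ (by linarith)
  have hm1 : x ^ 17 ≤ m := by rw [hm]; exact Nat.le_ceil _
  have hm2 : (m : ℝ) ≤ 2 * x ^ 17 := by
    have := Nat.ceil_lt_add_one (show (0 : ℝ) ≤ x ^ 17 by positivity)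
    rw [← hm] at this
    linarith
  have hmpos : (0 : ℝ) < m := by linarith
  have : NeZero m := ⟨by rintro rfl; simp at hmpos⟩
  let N : V → Finset V := fun v => Finset.univ.filter (H.Adj v)
  let E : V → (V → Fin m) → Prop := fun v f =>
    x ^ 4 ≤ 1 * (((N v).filter fun w => f w = 0).card : ℝ) ∨
      (x ^ 20 / 20000 ≤ (degIn H v U : ℝ) ∧
        -(3 * x) ≤ (-1) * ((((N v) ∩ U).filter fun w => f w = 0).card : ℝ))
  have hexp : Real.exp 1 - 1 ≤ 2 := by
    have := Real.exp_one_lt_d9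
    linarith
  have hexp' : Real.exp (-1) - 1 ≤ -(1 / 2) := by
    have := Real.exp_one_gt_d9
    rw [Real.exp_neg]
    have : (Real.exp 1)⁻¹ ≤ 2⁻¹ := inv_anti₀ (by norm_num) (by linarith)
    linarith
  have hNcard : ∀ v, ((N v).card : ℝ) ≤ 40 * x ^ 20 := by
    intro v
    refine le_trans ?_ (hdeg v)
    simp only [degIn, N]
    norm_cast
  have hUcard : ∀ v, ((N v ∩ U).card : ℝ) = degIn H v U := by
    intro v
    simp only [degIn, N]
    norm_cast
    congr 1
    ext w
    simp [and_comm]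
  have hq : ∀ v, ((Finset.univ.filter (E v)).card : ℝ) ≤
      (2 * Real.exp (-x)) * Fintype.card (V → Fin m) := by
    intro v
    let A := Finset.univ.filter fun f : V → Fin m =>
      x ^ 4 ≤ 1 * (((N v).filter fun w => f w = 0).card : ℝ)
    let B := Finset.univ.filter fun f : V → Fin m =>
      -(3 * x) ≤ (-1) * ((((N v) ∩ U).filter fun w => f w = 0).card : ℝ)
    have h1 : (A.card : ℝ) ≤ _ := card_filter_color_class_le m (N v) 1 (x ^ 4)
    have h2 : (B.card : ℝ) ≤ _ := card_filter_color_class_le m (N v ∩ U) (-1) (-(3 * x))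
    have hs1 : -x ^ 4 + ((N v).card : ℝ) * ((Real.exp 1 - 1) / m) ≤ -x := by
      have : ((N v).card : ℝ) * ((Real.exp 1 - 1) / m) ≤ 80 * x ^ 3 := by
        rw [← mul_div_assoc, div_le_iff₀ hmpos]
        have a1 : ((N v).card : ℝ) * (Real.exp 1 - 1) ≤ 40 * x ^ 20 * 2 :=
          mul_le_mul (hNcard v) hexp (by have := Real.exp_one_gt_d9; linarith) (by positivity)
        have a2 : 80 * x ^ 3 * x ^ 17 ≤ 80 * x ^ 3 * m :=
          mul_le_mul_of_nonneg_left hm1 (by positivity)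
        nlinarith
      have : x ^ 4 = x ^ 3 * x := by ring
      have : x ≤ x ^ 3 := le_self_pow₀ (by linarith) (by norm_num)
      nlinarith
    by_cases hU : x ^ 20 / 20000 ≤ (degIn H v U : ℝ)
    · have hs2 : -(-(3 * x)) + ((N v ∩ U).card : ℝ) * ((Real.exp (-1) - 1) / m) ≤ -x := by
        have : ((N v ∩ U).card : ℝ) * ((Real.exp (-1) - 1) / m) ≤ -(x ^ 3 / 80000) := by
          rw [← mul_div_assoc, div_le_iff₀ hmpos, hUcard]
          have a1 := mul_le_mul_of_nonneg_left hexp' (Nat.cast_nonneg (α := ℝ) (degIn H v U))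
          have a2 := mul_le_mul_of_nonneg_left hm2 (show 0 ≤ x ^ 3 / 80000 by positivity)
          nlinarith
        have : x ^ 3 = x * (x * x) := by ring
        nlinarith
      have hle : ((Finset.univ.filter (E v)).card : ℝ) ≤ _ + _ := le_trans (by
        rw [← Nat.cast_add]
        refine Nat.cast_le.2 (le_trans (Finset.card_le_card ?_) (Finset.card_union_le A B))
        intro f hf
        rw [Finset.mem_union]
        rcases (Finset.mem_filter.1 hf).2 with hf | hf
        · exact Or.inl (Finset.mem_filter.2 ⟨Finset.mem_univ _, hf⟩)
        · exact Or.inr (Finset.mem_filter.2 ⟨Finset.mem_univ _, hf.2⟩)) (add_le_add h1 h2)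
      refine hle.trans ?_
      rw [← add_mul]
      refine mul_le_mul_of_nonneg_right ?_ (by positivity)
      have := Real.exp_le_exp.2 hs1
      have := Real.exp_le_exp.2 hs2
      linarith
    · have hle : ((Finset.univ.filter (E v)).card : ℝ) ≤ _ := le_trans (by
        refine Nat.cast_le.2 (Finset.card_le_card (t := A) ?_)
        intro f hf
        rcases (Finset.mem_filter.1 hf).2 with hf | hf
        · exact Finset.mem_filter.2 ⟨Finset.mem_univ _, hf⟩
        · exact absurd hf.1 hU) h1
      refine hle.trans (mul_le_mul_of_nonneg_right ?_ (by positivity))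
      have := Real.exp_le_exp.2 hs1
      have := Real.exp_pos (-x)
      linarith
  have hd : ∀ v, ((Finset.univ.filter fun w => ¬ Disjoint (N v) (N w)).card : ℝ) ≤
      1600 * x ^ 40 := by
    intro v
    have hsub : (Finset.univ.filter fun w => ¬ Disjoint (N v) (N w)) ⊆ (N v).biUnion N := by
      intro w hw
      obtain ⟨z, hz1, hz2⟩ := Finset.not_disjoint_iff.1 (Finset.mem_filter.1 hw).2
      refine Finset.mem_biUnion.2 ⟨z, hz1, ?_⟩
      simp only [N, Finset.mem_filter, Finset.mem_univ, true_and] at hz2 ⊢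
      exact hz2.symm
    have h1 : ((Finset.univ.filter fun w => ¬ Disjoint (N v) (N w)).card : ℝ) ≤
        ∑ z ∈ N v, ((N z).card : ℝ) := by
      exact_mod_cast (Finset.card_le_card hsub).trans Finset.card_biUnion_le
    refine h1.trans ((Finset.sum_le_sum fun z _ => hNcard z).trans ?_)
    rw [Finset.sum_const, nsmul_eq_mul]
    have := mul_le_mul_of_nonneg_right (hNcard v) (show 0 ≤ 40 * x ^ 20 by positivity)
    nlinarith
  obtain ⟨f, hf⟩ := exists_forall_not_of_local E N (by
      intro v f g hfg
      have e1 : ((N v).filter fun w => f w = 0) = (N v).filter fun w => g w = 0 :=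
        Finset.filter_congr fun w hw => by rw [hfg w hw]
      have e2 : ((N v ∩ U).filter fun w => f w = 0) = (N v ∩ U).filter fun w => g w = 0 :=
        Finset.filter_congr fun w hw => by rw [hfg w (Finset.mem_inter.1 hw).1]
      simp only [E, e1, e2]) (2 * Real.exp (-x)) (1600 * x ^ 40)
    (fun v => by convert hq v) hd (by positivity)
    (by nlinarith [Real.exp_pos (-x)]) (by
      have : (1 : ℝ) ≤ x ^ 40 := one_le_pow₀ (by linarith)
      nlinarith [Real.exp_pos (-x)])
  refine ⟨Finset.univ.filter fun w => f w = 0, fun v => ?_, fun v hv => ?_⟩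
  · by_contra! h
    refine hf v (Or.inl ?_)
    rw [one_mul]
    refine h.le.trans ?_
    simp only [degIn, N]
    norm_cast
    refine Finset.card_le_card fun w hw => ?_
    simp at hw ⊢
    exact ⟨hw.2, hw.1⟩
  · by_contra! h
    refine hf v (Or.inr ⟨hv, ?_⟩)
    have : (((N v ∩ U).filter fun w => f w = 0).card : ℝ) ≤
        degIn H v ((Finset.univ.filter fun w => f w = 0) ∩ U) := by
      simp only [degIn, N]
      norm_cast
      refine Finset.card_le_card fun w hw => ?_
      simp at hw ⊢
      exact ⟨⟨hw.2, hw.1.2⟩, hw.1.1⟩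
    linarith

end LocalLemma

/-! ### From degree conditions to a linear forest with prescribed inner vertices -/

section SubgraphOfForest

open SimpleGraph

/-- A forest in which the vertices of `T` have degree two, all others have degree at most one and
are only adjacent to vertices of `T`, is a linear forest with inner vertices `T`. -/
theorem exists_linearForest_of_forest {V : Type*} [Finite V] {H F : SimpleGraph V} (hFH : F ≤ H)
    (hF : F.IsAcyclic) (T : Set V) (hT : ∀ v ∈ T, deg F v = 2) (hU : ∀ v ∉ T, deg F v ≤ 1)
    (hUT : ∀ v ∉ T, ∀ z, F.Adj v z → z ∈ T) :
    ∃ Q : H.Subgraph, (∀ v w, Q.Adj v w ↔ F.Adj v w) ∧ IsLinearForest Q ∧ T ⊆ Q.verts ∧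
      (∀ c : Q.coe.ConnectedComponent, 3 ≤ c.supp.ncard) ∧
      (∀ v ∈ Q.verts, (v ∈ pathEndpoints Q → v ∈ Tᶜ) ∧ (v ∉ pathEndpoints Q → v ∈ T)) ∧
      ∀ v ∈ pathEndpoints Q, v ∉ T ∧ ∃ z, F.Adj v z := by
  let Q : H.Subgraph :=
    { verts := {v | v ∈ T ∨ ∃ z, F.Adj v z}
      Adj := F.Adj
      adj_sub := fun h => hFH h
      edge_vert := fun h => Or.inr ⟨_, h⟩
      symm := F.symm }
  have hdeg : ∀ v, (Q.neighborSet v).ncard = deg F v := fun v => rfl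
  have hac : Q.coe.IsAcyclic := hF.comap ⟨fun v => v.1, fun h => h⟩ Subtype.val_injective
  refine ⟨Q, fun v w => Iff.rfl, isLinearForest_of_ncard_neighborSet_le_two hac fun v _ => ?_,
    fun v hv => Or.inl hv, fun c => ?_, fun v hv => ⟨fun h hvT => ?_, fun h => ?_⟩,
    fun v h => ?_⟩
  · rw [hdeg]
    by_cases hv : v ∈ T
    · rw [hT v hv]
    · exact (hU v hv).trans (by omega)
  -- Every component meets `T`, and a vertex of `T` together with its two neighbours gives three
  -- vertices.
  · obtain ⟨t, ht, htT⟩ : ∃ t : Q.verts, t ∈ c.supp ∧ (t : V) ∈ T := by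
      obtain ⟨v, hv⟩ := c.nonempty_supp
      by_cases hvT : (v : V) ∈ T
      · exact ⟨v, hv, hvT⟩
      · obtain ⟨z, hz⟩ := v.2.resolve_left hvT
        have hzv : z ∈ Q.verts := Q.edge_vert (v := z) (w := v) hz.symm
        refine ⟨⟨z, hzv⟩, c.mem_supp_of_adj_mem_supp hv ?_, hUT _ hvT _ hz⟩
        exact hz
    have hsub : insert t (Q.coe.neighborSet t) ⊆ c.supp := by
      rintro z (rfl | hz)
      · exact ht
      · exact c.mem_supp_of_adj_mem_supp ht hz
    refine le_trans ?_ (Set.ncard_le_ncard hsub)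
    rw [Set.ncard_insert_of_notMem (Q.coe.notMem_neighborSet_self),
      Subgraph.ncard_neighborSet_coe, hdeg, hT _ htT]
  · have := h.2
    rw [hdeg, hT v hvT] at this
    omega
  · by_contra hvT
    exact h ⟨hv, hU v hvT⟩
  · have hvT : v ∉ T := fun hvT => by
      have := h.2
      rw [hdeg, hT v hvT] at this
      omega
    exact ⟨hvT, h.1.resolve_left hvT⟩

end SubgraphOfForest

/-! ### Low-degree vertices and their chosen neighbours -/

section ExceptionalVertices

open SimpleGraph

variable {V : Type*} {H : SimpleGraph V} {P : H.Subgraph}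

/-- Every vertex of degree at least two has two neighbours that include its neighbours in a given
linear forest. -/
theorem IsLinearForest.exists_pair_neighbors [Fintype V] (hP : IsLinearForest P) (h2 : ∀ v, 2 ≤ deg H v) :
    ∃ s : V → Fin 2 → V, ∀ v, (∀ j, H.Adj v (s v j)) ∧ Function.Injective (s v) ∧
      ∀ w, P.Adj v w → ∃ j, w = s v j := by
  classical
  suffices ∀ v, ∃ s : Fin 2 → V, (∀ j, H.Adj v (s j)) ∧ Function.Injective s ∧
      ∀ w, P.Adj v w → ∃ j, w = s j by
    choose s hs using this
    exact ⟨s, hs⟩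
  intro v
  have h1 : (Finset.univ.filter (P.Adj v)).card ≤ 2 := by
    have := hP.ncard_neighborSet_le_two v
    rw [← Set.ncard_coe_finset]
    convert this using 2
    ext w
    simp
  have h3 : 2 ≤ (Finset.univ.filter (H.Adj v)).card := by
    have := h2 v
    rw [deg] at this
    rw [← Set.ncard_coe_finset]
    convert this using 2
    ext w
    simp
  obtain ⟨D, hD1, hD2, hD⟩ := Finset.exists_subsuperset_card_eq
    (fun w hw => Finset.mem_filter.2 ⟨Finset.mem_univ _, (Finset.mem_filter.1 hw).2.adj_sub⟩ :
      Finset.univ.filter (P.Adj v) ⊆ Finset.univ.filter (H.Adj v)) h1 h3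
  obtain ⟨a, b, hab, rfl⟩ := Finset.card_eq_two.1 hD
  refine ⟨![a, b], fun j => ?_, fun i j hij => ?_, fun w hw => ?_⟩
  · fin_cases j
    · exact (Finset.mem_filter.1 (hD2 (by simp : a ∈ _))).2
    · exact (Finset.mem_filter.1 (hD2 (by simp : b ∈ _))).2
  · fin_cases i <;> fin_cases j <;> simp_all
  · have := hD1 (Finset.mem_filter.2 ⟨Finset.mem_univ w, hw⟩)
    simp only [Finset.mem_insert, Finset.mem_singleton] at this
    rcases this with rfl | rfl
    · exact ⟨0, rfl⟩
    · exact ⟨1, rfl⟩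

variable {L : Finset V} {s : V → Fin 2 → V}

/-- The form in which (A2) is applied: exhibiting a short walk identifies two low-degree vertices.
-/
theorem eq_of_walk_length_le_five (hL : ∀ u ∈ L, ∀ v ∈ L, u ≠ v → 5 < H.edist u v) {u v : V}
    (hu : u ∈ L) (hv : v ∈ L) (q : H.Walk u v) (hq : q.length ≤ 5) : u = v := by
  by_contra huv
  have h1 := hL u hu v hv huv
  have h2 : H.edist u v ≤ (q.length : ℕ∞) := edist_le q
  have h3 : (q.length : ℕ∞) ≤ 5 := by exact_mod_cast hq
  exact absurd (h1.trans_le (h2.trans h3)) (lt_irrefl _)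

theorem partner_notMem (hL : ∀ u ∈ L, ∀ v ∈ L, u ≠ v → 5 < H.edist u v)
    (hs : ∀ v j, H.Adj v (s v j)) {v : V} (hv : v ∈ L) (j : Fin 2) : s v j ∉ L := by
  intro h
  exact (hs v j).ne (eq_of_walk_length_le_five hL hv h (hs v j).toWalk (by simp))

theorem partner_injective (hL : ∀ u ∈ L, ∀ v ∈ L, u ≠ v → 5 < H.edist u v)
    (hs : ∀ v j, H.Adj v (s v j)) (hinj : ∀ v, Function.Injective (s v)) {v w : V} (hv : v ∈ L)
    (hw : w ∈ L) {i j : Fin 2} (h : s v i = s w j) : v = w ∧ i = j := by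
  have hvw : v = w := by
    have hA := hs w j
    rw [← h] at hA
    exact eq_of_walk_length_le_five hL hv hw (Walk.cons (hs v i) (Walk.cons hA.symm Walk.nil))
      (by simp)
  subst hvw
  exact ⟨rfl, hinj v h⟩

/-- Any two neighbours of `b` in this set belong to low-degree vertices joined through `b` by a walk
of length at most four. So they share one owner `v` and lie in {v, s v 0, s v 1}. -/
theorem degIn_union_partners_le [DecidableEq V]
    (hL : ∀ u ∈ L, ∀ v ∈ L, u ≠ v → 5 < H.edist u v) (hs : ∀ v j, H.Adj v (s v j)) (b : V) :
    degIn H b (L ∪ L.biUnion fun v => Finset.univ.image (s v)) ≤ 3 := by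
  classical
  have howner : ∀ z ∈ L ∪ L.biUnion fun v => Finset.univ.image (s v),
      ∃ v ∈ L, ∃ q : H.Walk v z, q.length ≤ 1 ∧ z ∈ ({v, s v 0, s v 1} : Finset V) := by
    intro z hz
    rcases Finset.mem_union.1 hz with hz | hz
    · exact ⟨z, hz, Walk.nil, by simp, by simp⟩
    · obtain ⟨v, hv, hz⟩ := Finset.mem_biUnion.1 hz
      obtain ⟨j, -, rfl⟩ := Finset.mem_image.1 hz
      refine ⟨v, hv, (hs v j).toWalk, by simp, ?_⟩
      fin_cases j <;> simp
  rcases ((L ∪ L.biUnion fun v => Finset.univ.image (s v)).filter (H.Adj b)).eq_empty_or_nonempty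
    with h | ⟨z, hz⟩
  · rw [degIn]
    convert Nat.zero_le 3
    rw [Finset.card_eq_zero]
    convert h
  · rw [Finset.mem_filter] at hz
    obtain ⟨v, hv, q, hq, -⟩ := howner z hz.1
    have hsub : (L ∪ L.biUnion fun v => Finset.univ.image (s v)).filter (H.Adj b) ⊆
        ({v, s v 0, s v 1} : Finset V) := by
      intro z' hz'
      rw [Finset.mem_filter] at hz'
      obtain ⟨v', hv', q', hq', hmem⟩ := howner z' hz'.1
      have := eq_of_walk_length_le_five hL hv hv'
        (q.append (Walk.cons hz.2.symm (Walk.cons hz'.2 q'.reverse))) (by simp; omega)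
      rwa [this]
    rw [degIn]
    convert (Finset.card_le_card hsub).trans Finset.card_le_three

end ExceptionalVertices

/-! ### Absorbing the exceptional vertices -/

section Absorption

open SimpleGraph

variable {V : Type} {H : SimpleGraph V} {P : H.Subgraph}

/-- The part of `P` that avoids the vertices of `C`. -/
def avoiding (P : H.Subgraph) (C : Finset V) : SimpleGraph V where
  Adj v w := P.Adj v w ∧ v ∉ C ∧ w ∉ C
  symm := ⟨fun _ _ h => ⟨h.1.symm, h.2.2, h.2.1⟩⟩
  loopless := ⟨fun _ h => h.1.ne rfl⟩

theorem avoiding_le_spanningCoe (C : Finset V) : avoiding P C ≤ P.spanningCoe := fun _ _ h => h.1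

theorem deg_avoiding_le_two [Finite V] (hP : IsLinearForest P) (C : Finset V) (v : V) :
    deg (avoiding P C) v ≤ 2 :=
  (Set.ncard_le_ncard (t := P.neighborSet v) fun _ h => h.1).trans (hP.ncard_neighborSet_le_two v)

open scoped Classical in
theorem card_filter_adj_le_two [Fintype V] (hP : IsLinearForest P) (v : V) :
    (Finset.univ.filter (P.Adj v)).card ≤ 2 := by
  have := hP.ncard_neighborSet_le_two v
  rw [← Set.ncard_coe_finset]
  convert this using 2
  ext w
  simp

open scoped Classical in
/-- Deleting the vertices of `C` from a linear forest creates few vertices of degree at most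
one. -/
theorem card_filter_deg_avoiding_lt_two_le [Fintype V] (hP : IsLinearForest P) (C S : Finset V)
    (hS : P.verts = S) : (S.filter fun v => deg (avoiding P C) v < 2).card ≤
      (pathEndpoints P).ncard + 3 * C.card := by
  have hsub : (S.filter fun v => deg (avoiding P C) v < 2) ⊆
      (pathEndpoints P).toFinset ∪ (C ∪ C.biUnion fun v => Finset.univ.filter (P.Adj v)) := by
    intro v hv
    rw [Finset.mem_filter] at hv
    rw [Finset.mem_union, Finset.mem_union, Set.mem_toFinset]
    by_contra! h
    obtain ⟨h1, h2, h3⟩ := h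
    have hvS : v ∈ P.verts := by rw [hS]; exact hv.1
    have h4 : ¬ (P.neighborSet v).ncard ≤ 1 := fun h => h1 ⟨hvS, h⟩
    have h5 : (avoiding P C).neighborSet v = P.neighborSet v := by
      ext w
      refine ⟨fun h => h.1, fun h => ⟨h, h2, fun hw => h3 ?_⟩⟩
      exact Finset.mem_biUnion.2 ⟨w, hw, Finset.mem_filter.2 ⟨Finset.mem_univ _, h.symm⟩⟩
    rw [deg, h5] at hv
    omega
  refine (Finset.card_le_card hsub).trans ((Finset.card_union_le _ _).trans ?_)
  have h1 : (C.biUnion fun v => Finset.univ.filter (P.Adj v)).card ≤ C.card * 2 :=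
    Finset.card_biUnion_le_card_mul _ _ _ fun v _ => card_filter_adj_le_two hP v
  have h2 := Finset.card_union_le C (C.biUnion fun v => Finset.univ.filter (P.Adj v))
  rw [Set.ncard_eq_toFinset_card']
  omega

open scoped Classical in
/-- Deleting the vertices of `C` from a linear forest deletes few edges. -/
theorem ncard_edgeSet_diff_le [Fintype V] (hP : IsLinearForest P) (C : Finset V) (E : Set (Sym2 V))
    (hE : ∀ v w, (avoiding P C).Adj v w → s(v, w) ∈ E) :
    (P.edgeSet \ E).ncard ≤ 2 * C.card := by
  have hsub : P.edgeSet \ E ⊆ ((C.biUnion fun v =>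
      (Finset.univ.filter (P.Adj v)).image fun w => s(v, w) : Finset (Sym2 V)) : Set (Sym2 V)) := by
    rintro e ⟨he, heE⟩
    induction e using Sym2.ind with
    | h v w =>
      rw [Subgraph.mem_edgeSet] at he
      rw [Finset.mem_coe, Finset.mem_biUnion]
      by_cases hv : v ∈ C
      · exact ⟨v, hv, Finset.mem_image.2 ⟨w, by simp [he], rfl⟩⟩
      by_cases hw : w ∈ C
      · exact ⟨w, hw, Finset.mem_image.2 ⟨v, by simp [he.symm], Sym2.eq_swap⟩⟩
      · exact absurd (hE v w ⟨he, hv, hw⟩) heE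
  refine (Set.ncard_le_ncard hsub).trans ?_
  rw [Set.ncard_coe_finset, mul_comm]
  exact Finset.card_biUnion_le_card_mul _ _ _ fun v _ =>
    Finset.card_image_le.trans (card_filter_adj_le_two hP v)

/-- Absorption of exceptional vertices: a linear forest `P` on `S` can be modified so that it
covers `S` together with a small set `B` of exceptional vertices. -/
theorem exists_absorbing_linearForest [Fintype V] [DecidableEq V] {x c : ℝ} (hx : 1000 ≤ x) (hP : IsLinearForest P)
    (S D : Finset V) (hS : P.verts = S) (hH2 : ∀ v, 2 ≤ deg H v)
    (L : Finset V) (hL : ∀ v, v ∈ L ↔ (deg H v : ℝ) ≤ x ^ 20 / 5000)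
    (hdist : ∀ u ∈ L, ∀ v ∈ L, u ≠ v → 5 < H.edist u v) (hLD : L ⊆ D)
    (hD : ∀ v ∉ D, x ^ 20 / 10 ≤ (degIn H v Sᶜ : ℝ)) (hDc : (D.card : ℝ) ≤ c)
    (hends : ((pathEndpoints P).ncard : ℝ) ≤ c) (hsparse : LocallySparse H (200 * c) x)
    (htrans : ∀ U : Finset V, ∃ R : Finset V, (∀ v, (degIn H v R : ℝ) ≤ x ^ 4) ∧
        ∀ v, x ^ 20 / 20000 ≤ (degIn H v U : ℝ) → 3 * x < (degIn H v (R ∩ U) : ℝ)) :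
    ∃ (B : Finset V) (Q : H.Subgraph), D ⊆ B ∧ (B.card : ℝ) ≤ 6 * c ∧
      (∀ v ∉ B, (degIn H v B : ℝ) ≤ 3 * x) ∧ IsLinearForest Q ∧
      ((S ∪ B : Finset V) : Set V) ⊆ Q.verts ∧
      ((P.edgeSet \ Q.edgeSet).ncard : ℝ) ≤ 36 * c ∧ (numPaths Q : ℝ) ≤ 122 * c ∧
      (∀ C : Q.coe.ConnectedComponent, 3 ≤ C.supp.ncard) ∧
      (∀ v ∈ Q.verts, (v ∈ pathEndpoints Q → v ∈ ((S ∪ B : Finset V) : Set V)ᶜ) ∧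
        (v ∉ pathEndpoints Q → v ∈ ((S ∪ B : Finset V) : Set V))) ∧
      ∀ u, (degInto H u (pathEndpoints Q) : ℝ) ≤ x ^ 4 := by
  classical
  have hc0 : 0 ≤ c := (Nat.cast_nonneg _).trans hDc
  have hx0 : 0 < x := by linarith
  have hxN : 1000000 * x ≤ x ^ 20 := by
    have h1 : (1000 : ℝ) ^ 19 ≤ x ^ 19 := pow_le_pow_left₀ (by norm_num) hx 19
    have h2 : x ^ 20 = x ^ 19 * x := by ring
    rw [h2]
    exact mul_le_mul_of_nonneg_right (le_trans (by norm_num) h1) hx0.le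
  obtain ⟨sp, hsp⟩ := hP.exists_pair_neighbors hH2
  have hspA : ∀ v j, H.Adj v (sp v j) := fun v => (hsp v).1
  have hspI : ∀ v, Function.Injective (sp v) := fun v => (hsp v).2.1
  have hspP : ∀ v w, P.Adj v w → ∃ j, w = sp v j := fun v => (hsp v).2.2
  let Sp : Finset V := L.biUnion fun v => Finset.univ.image (sp v)
  have hSp : ∀ v ∈ L, ∀ j, sp v j ∈ Sp := fun v hv j =>
    Finset.mem_biUnion.2 ⟨v, hv, Finset.mem_image.2 ⟨j, Finset.mem_univ _, rfl⟩⟩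
  have hSpL : ∀ z ∈ Sp, z ∉ L := by
    intro z hz
    obtain ⟨v, hv, hz⟩ := Finset.mem_biUnion.1 hz
    obtain ⟨j, -, rfl⟩ := Finset.mem_image.1 hz
    exact partner_notMem hdist hspA hv j
  have hSpcard : Sp.card ≤ 2 * D.card := by
    have : Sp.card ≤ L.card * 2 := Finset.card_biUnion_le_card_mul _ _ _ fun v _ =>
      Finset.card_image_le.trans (by simp)
    have := Finset.card_le_card hLD
    omega
  have hC0card : (D ∪ Sp).card ≤ 3 * D.card := by
    have := Finset.card_union_le D Sp
    omega
  have hC0card' : ((D ∪ Sp).card : ℝ) ≤ 3 * D.card := by exact_mod_cast hC0card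
  -- Including the partners `Sp` in `B` ensures that they are isolated by the cut and lie outside
  -- `U`. The sizes here are 3c before and 6c after the closure.
  obtain ⟨B, hCB, hBcard, hBdeg⟩ := hsparse.exists_closure hx0 (D ∪ Sp) (by linarith)
  have hBc : (B.card : ℝ) ≤ 6 * c := by
    have : (B.card : ℝ) ≤ 2 * (D ∪ Sp).card := by exact_mod_cast hBcard
    linarith
  have hDB : D ⊆ B := Finset.subset_union_left.trans hCB
  have hSpB : Sp ⊆ B := Finset.subset_union_right.trans hCB
  have hLB : L ⊆ B := hLD.trans hDB
  obtain ⟨ρ, hρ, hρB⟩ := hsparse.exists_ordering B (by linarith)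
  obtain ⟨U, hUdef⟩ : ∃ U : Finset V, U = (S ∪ B)ᶜ := ⟨_, rfl⟩
  have hU : ∀ v, v ∈ U ↔ v ∉ S ∧ v ∉ B := by
    intro v; rw [hUdef]; simp
  -- The vertices of `B` that cannot rely on neighbours in `U`, although their degree is not low.
  let BN : Finset V := (B \ L).filter fun b => (degIn H b U : ℝ) < x ^ 20 / 20000
  have hBNB : BN ⊆ B := (Finset.filter_subset _ _).trans Finset.sdiff_subset
  have hBNL : ∀ b ∈ BN, b ∉ L := fun b hb =>
    (Finset.mem_sdiff.1 (Finset.mem_filter.1 hb).1).2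
  -- Candidates avoid the partners, so that targets stay private, and avoid low-degree and earlier
  -- vertices, so that targets are treated after `b`. Of more than x^20/5000 neighbours this
  -- excludes fewer than x^20/20000 + 3 + x.
  let N₁ : V → Finset V := fun b => Finset.univ.filter fun w =>
    H.Adj b w ∧ w ∉ U ∧ w ∉ L ∪ Sp ∧ ¬ (w ∈ B ∧ ρ w ≤ ρ b)
  have hN₁ : ∀ b ∈ BN, 3 * x < ((N₁ b).card : ℝ) := by
    intro b hb
    have h1 : x ^ 20 / 5000 < (deg H b : ℝ) := by
      by_contra! h
      exact hBNL b hb ((hL b).2 h)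
    have h2 := (Finset.mem_filter.1 hb).2
    have h3 : (degIn H b (L ∪ Sp) : ℝ) ≤ 3 := by
      exact_mod_cast degIn_union_partners_le hdist hspA b
    have h4 := hρB b (hBNB hb)
    have h5 : degIn H b Finset.univ ≤ (N₁ b).card + degIn H b U + degIn H b (L ∪ Sp) +
        degIn H b (B.filter fun b' => ρ b' ≤ ρ b) := by
      have hsub : Finset.univ.filter (H.Adj b) ⊆ (N₁ b ∪ U.filter (H.Adj b) ∪
          (L ∪ Sp).filter (H.Adj b)) ∪ (B.filter fun b' => ρ b' ≤ ρ b).filter (H.Adj b) := by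
        intro w hw
        have hw := (Finset.mem_filter.1 hw).2
        simp only [N₁, Finset.mem_union, Finset.mem_filter, Finset.mem_univ, true_and, hw, and_true]
        tauto
      have e1 := Finset.card_le_card hsub
      have e2 := Finset.card_union_le (N₁ b ∪ U.filter (H.Adj b) ∪
          (L ∪ Sp).filter (H.Adj b)) ((B.filter fun b' => ρ b' ≤ ρ b).filter (H.Adj b))
      have e3 := Finset.card_union_le (N₁ b ∪ U.filter (H.Adj b)) ((L ∪ Sp).filter (H.Adj b))
      have e4 := Finset.card_union_le (N₁ b) (U.filter (H.Adj b))
      unfold degIn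
      exact e1.trans (e2.trans (Nat.add_le_add_right (e3.trans (Nat.add_le_add_right e4 _)) _))
    rw [deg_eq_degIn_univ] at h1
    have h6 : (degIn H b Finset.univ : ℝ) ≤ (N₁ b).card + degIn H b U + degIn H b (L ∪ Sp) +
        degIn H b (B.filter fun b' => ρ b' ≤ ρ b) := by exact_mod_cast h5
    linarith
  have hBNc : (BN.card : ℝ) ≤ 6 * c := le_trans (by exact_mod_cast Finset.card_le_card hBNB) hBc
  obtain ⟨f, hfN, hfinj⟩ := hsparse.exists_private_neighbors BN (by linarith) N₁
    (fun b _ w hw => (Finset.mem_filter.1 hw).2.1) hx0 hN₁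
  have hf : ∀ b ∈ BN, ∀ j, H.Adj b (f b j) ∧ f b j ∉ U ∧ f b j ∉ L ∪ Sp ∧
      ¬ (f b j ∈ B ∧ ρ (f b j) ≤ ρ b) := fun b hb j => (Finset.mem_filter.1 (hfN b hb j)).2
  let Fim : Finset V := BN.biUnion fun b => Finset.univ.image (f b)
  have hFim : ∀ b ∈ BN, ∀ j, f b j ∈ Fim := fun v hv j =>
    Finset.mem_biUnion.2 ⟨v, hv, Finset.mem_image.2 ⟨j, Finset.mem_univ _, rfl⟩⟩
  have hFimcard : Fim.card ≤ BN.card * 2 := Finset.card_biUnion_le_card_mul _ _ _ fun v _ =>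
      Finset.card_image_le.trans (by simp)
  -- Cutting at the targets of `BN` as well makes them isolated. They may lie in S outside `B`, and
  -- then reappear in `Y` below.
  obtain ⟨Cut, hCut⟩ : ∃ Cut, Cut = B ∪ Fim := ⟨_, rfl⟩
  have hBCut : B ⊆ Cut := hCut ▸ Finset.subset_union_left
  have hFCut : Fim ⊆ Cut := hCut ▸ Finset.subset_union_right
  have hCutc : (Cut.card : ℝ) ≤ 18 * c := by
    have h1 := Finset.card_union_le B Fim
    have h2 : (Cut.card : ℝ) ≤ B.card + BN.card * 2 := by
      rw [hCut]; exact_mod_cast h1.trans (by omega)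
    linarith
  let F₀ := avoiding P Cut
  -- Vertices of S outside `B` with missing degree: old endpoints, cut vertices and their old
  -- neighbours, at most c + 3 · 18c = 55c in number.
  let Y : Finset V := (S.filter fun v => deg F₀ v < 2) \ B
  have hYc : (Y.card : ℝ) ≤ 55 * c := by
    have h1 := (Finset.card_le_card (Finset.sdiff_subset (s := S.filter fun v => deg F₀ v < 2)
      (t := B))).trans (card_filter_deg_avoiding_lt_two_le hP Cut S hS)
    have h2 : (Y.card : ℝ) ≤ (pathEndpoints P).ncard + 3 * Cut.card := by exact_mod_cast h1
    linarith
  let X₂ : Finset V := ((B \ L) \ BN) ∪ Y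
  have hX₂c : (X₂.card : ℝ) ≤ 61 * c := by
    have h1 : X₂.card ≤ B.card + Y.card := (Finset.card_union_le _ _).trans
      (Nat.add_le_add_right (Finset.card_le_card
        (Finset.sdiff_subset.trans Finset.sdiff_subset)) _)
    have h2 : (X₂.card : ℝ) ≤ B.card + Y.card := by exact_mod_cast h1
    linarith
  have hX₂U : ∀ v ∈ X₂, x ^ 20 / 20000 ≤ (degIn H v U : ℝ) := by
    intro v hv
    rcases Finset.mem_union.1 hv with hv | hv
    · rw [Finset.mem_sdiff] at hv
      by_contra! h
      exact hv.2 (Finset.mem_filter.2 ⟨hv.1, h⟩)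
    -- Outside `B`, hence outside `D`, a vertex has x^20/10 neighbours off S and loses at most 3x of
    -- them to `B`.
    · have hvB := (Finset.mem_sdiff.1 hv).2
      have h1 := hD v (fun h => hvB (hDB h))
      have h2 := hBdeg v hvB
      have h3 : degIn H v Sᶜ ≤ degIn H v (Sᶜ \ B) + degIn H v B := degIn_sdiff_ge
      have h4 : Sᶜ \ B = U := by ext z; rw [hU]; simp
      rw [h4] at h3
      have h5 : (degIn H v Sᶜ : ℝ) ≤ degIn H v U + degIn H v B := by exact_mod_cast h3
      linarith
  obtain ⟨R, hR1, hR2⟩ := htrans U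
  -- The sparsity range 200c is needed here: 3 · 61c = 183c.
  obtain ⟨g, hgN, hginj⟩ := hsparse.exists_private_neighbors X₂ (by linarith)
    (fun v => (R ∩ U).filter (H.Adj v)) (fun b _ w hw => (Finset.mem_filter.1 hw).2) hx0
    (fun v hv => by
      have := hR2 v (hX₂U v hv)
      unfold degIn at this
      exact this)
  have hg : ∀ v ∈ X₂, ∀ j, H.Adj v (g v j) ∧ g v j ∈ R ∧ g v j ∈ U := fun v hv j => by
    have := Finset.mem_filter.1 (hgN v hv j)
    exact ⟨this.2, (Finset.mem_inter.1 this.1).1, (Finset.mem_inter.1 this.1).2⟩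
  have hX₂L : ∀ v ∈ X₂, v ∉ L ∧ v ∉ BN := by
    intro v hv
    rcases Finset.mem_union.1 hv with hv | hv
    · rw [Finset.mem_sdiff, Finset.mem_sdiff] at hv
      exact ⟨hv.1.2, hv.2⟩
    · have hvB := (Finset.mem_sdiff.1 hv).2
      exact ⟨fun h => hvB (hLB h), fun h => hvB (hBNB h)⟩
  have hX₂U' : ∀ v ∈ X₂, v ∉ U := by
    intro v hv hvU
    rw [hU] at hvU
    rcases Finset.mem_union.1 hv with hv | hv
    · rw [Finset.mem_sdiff, Finset.mem_sdiff] at hv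
      exact hvU.2 hv.1.1
    · exact hvU.1 (Finset.mem_filter.1 (Finset.mem_sdiff.1 hv).1).1
  let A : Finset V := L ∪ BN ∪ X₂
  have hAU : ∀ v ∈ A, v ∉ U := by
    intro v hv hvU
    have hvU' := (hU v).1 hvU
    rcases Finset.mem_union.1 hv with hv | hv
    · rcases Finset.mem_union.1 hv with hv | hv
      · exact hvU'.2 (hLB hv)
      · exact hvU'.2 (hBNB hv)
    · exact hX₂U' v hv hvU
  let h : V → Fin 2 → V := fun v => if v ∈ L then sp v else if v ∈ BN then f v else g v
  -- Low-degree vertices come first, then `BN` in the order of `ρ`, then the vertices with targets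
  -- in `U`. The value 2 + |B| exceeds every 1 + ρ.
  let rk : V → ℕ := fun v => if v ∈ L then 0 else if v ∈ BN then 1 + ρ v else 2 + B.card
  have hA : ∀ a ∈ A, (a ∈ L ∧ h a = sp a ∧ rk a = 0) ∨ (a ∈ BN ∧ h a = f a ∧ rk a = 1 + ρ a) ∨
      (a ∈ X₂ ∧ h a = g a ∧ rk a = 2 + B.card) := by
    intro a ha
    rcases Finset.mem_union.1 ha with ha | ha
    · rcases Finset.mem_union.1 ha with ha | ha
      · left; simp [h, rk, ha]
      · right; left; simp [h, rk, ha, hBNL a ha]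
    · right; right; simp [h, rk, ha, (hX₂L a ha).1, (hX₂L a ha).2]
  have hrkL : ∀ a, a ∉ L → 1 ≤ rk a := by
    intro a ha
    simp only [rk, ha, if_false]
    split_ifs <;> omega
  have hiso : ∀ v, v ∈ Cut ∨ v ∈ U → ∀ z, ¬ F₀.Adj v z := by
    rintro v (hv | hv) z hz
    · exact hz.2.1 hv
    · have := P.edge_vert hz.1
      rw [hS] at this
      exact ((hU v).1 hv).1 this
  have hhiso : ∀ a ∈ A, ∀ j, h a j ∈ Cut ∨ h a j ∈ U := by
    intro a ha j
    rcases hA a ha with ⟨ha, he, -⟩ | ⟨ha, he, -⟩ | ⟨ha, he, -⟩ <;> rw [he]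
    · exact Or.inl (hBCut (hSpB (hSp a ha j)))
    · exact Or.inl (hFCut (hFim a ha j))
    · exact Or.inr (hg a ha j).2.2
  have hhadj : ∀ a ∈ A, ∀ j, H.Adj a (h a j) := by
    intro a ha j
    rcases hA a ha with ⟨ha, he, -⟩ | ⟨ha, he, -⟩ | ⟨ha, he, -⟩ <;> rw [he]
    · exact hspA a j
    · exact (hf a ha j).1
    · exact (hg a ha j).1
  have hhU : ∀ a ∈ A, ∀ j, h a j ∈ U → h a j ∈ R := by
    intro a ha j hj
    rcases hA a ha with ⟨ha, he, -⟩ | ⟨ha, he, -⟩ | ⟨ha, he, -⟩ <;> rw [he] at hj ⊢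
    · exact absurd (hSpB (hSp a ha j)) ((hU _).1 hj).2
    · exact absurd hj (hf a ha j).2.1
    · exact (hg a ha j).2.1
  have d1 : ∀ a ∈ L, ∀ b ∈ BN, ∀ i j, sp a i ≠ f b j := fun a ha b hb i j e =>
    (hf b hb j).2.2.1 (Finset.mem_union_right _ (e ▸ hSp a ha i))
  have d2 : ∀ a ∈ L, ∀ b ∈ X₂, ∀ i j, sp a i ≠ g b j := fun a ha b hb i j e =>
    ((hU _).1 (hg b hb j).2.2).2 (e ▸ hSpB (hSp a ha i))
  have d3 : ∀ a ∈ BN, ∀ b ∈ X₂, ∀ i j, f a i ≠ g b j := fun a ha b hb i j e =>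
    (hf a ha i).2.1 (e ▸ (hg b hb j).2.2)
  obtain ⟨F, hF₀F, hFac, hFadj, hFA, hFg, hFo⟩ := exists_forest_extension rk h A F₀
    (hP.isAcyclic_spanningCoe.anti (avoiding_le_spanningCoe Cut)) (deg_avoiding_le_two hP Cut)
    (fun a ha j => hiso _ (hhiso a ha j))
    (by
      intro a ha b hb i j e
      rcases hA a ha with ⟨ha, he, -⟩ | ⟨ha, he, -⟩ | ⟨ha, he, -⟩ <;>
      rcases hA b hb with ⟨hb, he', -⟩ | ⟨hb, he', -⟩ | ⟨hb, he', -⟩ <;> rw [he, he'] at e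
      · exact partner_injective hdist hspA hspI ha hb e
      · exact absurd e (d1 a ha b hb i j)
      · exact absurd e (d2 a ha b hb i j)
      · exact absurd e.symm (d1 b hb a ha j i)
      · exact hfinj a ha b hb i j e
      · exact absurd e (d3 a ha b hb i j)
      · exact absurd e.symm (d2 b hb a ha j i)
      · exact absurd e.symm (d3 b hb a ha j i)
      · exact hginj a ha b hb i j e)
    (by
      intro a ha j hj
      rcases hA a ha with ⟨ha, he, hr⟩ | ⟨ha, he, hr⟩ | ⟨ha, he, hr⟩
      · rw [hr]
        refine hrkL _ ?_
        rw [he]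
        exact hSpL _ (hSp a ha j)
      · rw [hr]
        rw [he] at hj ⊢
        obtain ⟨-, -, h2, h3⟩ := hf a ha j
        rcases hA _ hj with ⟨hb, -, -⟩ | ⟨hb, -, hr'⟩ | ⟨hb, -, hr'⟩
        · exact absurd (Finset.mem_union_left _ hb) h2
        · rw [hr']
          by_contra hlt
          exact h3 ⟨hBNB hb, by omega⟩
        · rw [hr']
          have := hρ a (hBNB ha)
          omega
      · rw [he] at hj
        exact absurd (hg a ha j).2.2 (hAU _ hj))
  have hTU : ∀ v, v ∉ ((S ∪ B : Finset V) : Set V) ↔ v ∈ U := by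
    intro v; rw [hU]; simp
  have hFH : F ≤ H := by
    intro v w hvw
    rcases hFadj v w hvw with hvw | ⟨a, ha, j, ⟨rfl, rfl⟩ | ⟨rfl, rfl⟩⟩
    · exact hvw.1.adj_sub
    · exact hhadj _ ha j
    · exact (hhadj _ ha j).symm
  have hUadj : ∀ v ∈ U, ∀ z, F.Adj v z → ∃ a ∈ A, ∃ j, z = a ∧ v = h a j := by
    intro v hv z hvz
    rcases hFadj v z hvz with hvz | ⟨a, ha, j, ⟨rfl, rfl⟩ | ⟨rfl, rfl⟩⟩
    · exact absurd hvz (hiso v (Or.inr hv) z)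
    · exact absurd hv (hAU _ ha)
    · exact ⟨_, ha, j, rfl, rfl⟩
  obtain ⟨Q, hQadj, hQlin, hQT, hQ3, hQend, hQe⟩ := exists_linearForest_of_forest hFH hFac
    ((S ∪ B : Finset V) : Set V)
    (by
      intro v hv
      by_cases hvA : v ∈ A
      · exact hFA v hvA
      have hvB : v ∉ B := by
        intro hvB
        refine hvA ?_
        -- All of `B` lies in `A`, so an untreated vertex of T lies in S and had degree two already
        -- after the cut; it is not isolated and so is nobody's target.
        simp only [A, X₂, Finset.mem_union, Finset.mem_sdiff]
        tauto
      have hvS : v ∈ S := by simpa [hvB] using hv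
      have h2 : deg F₀ v = 2 := by
        have h1 := deg_avoiding_le_two hP Cut v
        by_contra hne
        refine hvA (Finset.mem_union_right _ (Finset.mem_union_right _ ?_))
        exact Finset.mem_sdiff.2 ⟨Finset.mem_filter.2 ⟨hvS, lt_of_le_of_ne h1 hne⟩, hvB⟩
      rw [hFo v hvA, h2]
      rintro a ha j rfl
      rw [deg_eq_zero_of_isolated (hiso _ (hhiso a ha j))] at h2
      omega)
    (by
      intro v hv
      have hvU := (hTU v).1 hv
      have hvA : v ∉ A := fun hvA => hAU v hvA hvU
      by_cases ht : ∃ a ∈ A, ∃ j, v = h a j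
      · exact hFg v hvA ht
      · push Not at ht
        rw [hFo v hvA ht, deg_eq_zero_of_isolated (hiso v (Or.inr hvU))]
        omega)
    (by
      intro v hv z hvz
      obtain ⟨a, ha, j, rfl, -⟩ := hUadj v ((hTU v).1 hv) z hvz
      by_contra hzT
      exact hAU _ ha ((hTU _).1 hzT))
  have hends_sub : ∀ v ∈ pathEndpoints Q, v ∈ R ∧ ∃ a ∈ A, ∃ j, v = h a j := by
    intro v hv
    obtain ⟨hvT, z, hvz⟩ := hQe v hv
    have hvU := (hTU v).1 hvT
    obtain ⟨a, ha, j, -, rfl⟩ := hUadj v hvU z hvz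
    exact ⟨hhU a ha j hvU, a, ha, j, rfl⟩
  refine ⟨B, Q, hDB, hBc, hBdeg, hQlin, hQT, ?_, ?_, hQ3, hQend, ?_⟩
  · have h1 := ncard_edgeSet_diff_le hP Cut Q.edgeSet fun v w hvw =>
      Subgraph.mem_edgeSet.2 ((hQadj v w).2 (hF₀F hvw))
    have h2 : ((P.edgeSet \ Q.edgeSet).ncard : ℝ) ≤ 2 * Cut.card := by exact_mod_cast h1
    linarith
  -- Every endpoint of `Q` is a target, and A ⊆ B ∪ Y gives at most 2(6c + 55c) of them.
  · have h1 : (pathEndpoints Q).ncard ≤ A.card * 2 := by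
      refine (Set.ncard_le_ncard (t := ((A.biUnion fun a => Finset.univ.image (h a) :
        Finset V) : Set V)) fun v hv => ?_).trans ?_
      · obtain ⟨-, a, ha, j, rfl⟩ := hends_sub v hv
        exact Finset.mem_coe.2 (Finset.mem_biUnion.2
          ⟨a, ha, Finset.mem_image.2 ⟨j, Finset.mem_univ _, rfl⟩⟩)
      · rw [Set.ncard_coe_finset]
        exact Finset.card_biUnion_le_card_mul _ _ _ fun v _ =>
          Finset.card_image_le.trans (by simp)
    have h2 : A.card ≤ B.card + Y.card := by
      refine (Finset.card_le_card (t := B ∪ Y) fun v hv => ?_).trans (Finset.card_union_le _ _)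
      simp only [A, X₂, Finset.mem_union, Finset.mem_sdiff] at hv ⊢
      rcases hv with (hv | hv) | hv | hv
      · exact Or.inl (hLB hv)
      · exact Or.inl (hBNB hv)
      · exact Or.inl hv.1.1
      · exact Or.inr hv
    have h3 := hQlin.numPaths_le
    have h4 : (numPaths Q : ℝ) ≤ (B.card + Y.card) * 2 := by
      exact_mod_cast h3.trans (h1.trans (Nat.mul_le_mul_right 2 h2))
    linarith
  · intro u
    refine le_trans ?_ (hR1 u)
    rw [← degInto_coe]
    norm_cast
    exact Set.ncard_le_ncard (Set.inter_subset_inter_right _ fun v hv => (hends_sub v hv).1)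

end Absorption

/-! ### Exponential moments of edge counts in the binomial random graph -/

section RandomGraph

open SimpleGraph MeasureTheory

variable {V : Type} [Fintype V]

open scoped Classical in
/-- Exponential Markov inequality for weighted edge counts in the binomial random graph. -/
theorem binomialRandom_real_le_exp (p : unitInterval) (c : Sym2 V → ℝ) (t : ℝ)
    (𝒜 : Set (SimpleGraph V)) (h𝒜 : ∀ G ∈ 𝒜, t ≤ ∑ e ∈ G.edgeFinset, c e) :
    (binomialRandom V p).real 𝒜 ≤ Real.exp (-t + p *
      ∑ e ∈ Finset.univ.filter (fun e : Sym2 V => ¬ e.IsDiag), (Real.exp (c e) - 1)) := by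
  have hp0 : (0 : ℝ) ≤ p := p.2.1
  have hp1 : (0 : ℝ) ≤ 1 - p := sub_nonneg.2 p.2.2
  let E₀ : Finset (Sym2 V) := Finset.univ.filter fun e => ¬ e.IsDiag
  have hE₀ : E₀.card = (Nat.card V).choose 2 := by
    rw [Nat.card_eq_fintype_card, ← Sym2.card_subtype_not_diag, Fintype.card_subtype]
  have hsub : ∀ G : SimpleGraph V, G.edgeFinset ⊆ E₀ := fun G e he =>
    Finset.mem_filter.2 ⟨Finset.mem_univ _, G.not_isDiag_of_mem_edgeFinset he⟩
  have hsingle : ∀ G : SimpleGraph V, (binomialRandom V p).real {G} =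
      (p : ℝ) ^ G.edgeFinset.card * (1 - p : ℝ) ^ (E₀ \ G.edgeFinset).card := by
    intro G
    rw [Measure.real, binomialRandom_singleton, Finset.card_sdiff_of_subset (hsub G), hE₀,
      ← coe_edgeFinset, Set.ncard_coe_finset]
    simp [unitInterval.coe_toNNReal]
  have hprod : ∑ G : SimpleGraph V, (binomialRandom V p).real {G} *
      Real.exp (∑ e ∈ G.edgeFinset, c e) ≤ ∏ e ∈ E₀, ((p : ℝ) * Real.exp (c e) + (1 - p)) := by
    -- Expanding the product gives one term for each set of pairs, and the graphs account for some
    -- of these sets; the other terms are nonnegative.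
    rw [Finset.prod_add]
    have hinj : Set.InjOn (fun G : SimpleGraph V => G.edgeFinset) ((Finset.univ : Finset (SimpleGraph V)) : Set _) :=
      fun G _ G' _ h => edgeFinset_inj.1 h
    have himg : (Finset.univ.image fun G : SimpleGraph V => G.edgeFinset) ⊆ E₀.powerset := by
      intro s hs
      obtain ⟨G, -, rfl⟩ := Finset.mem_image.1 hs
      exact Finset.mem_powerset.2 (hsub G)
    refine le_trans (le_of_eq ?_) (Finset.sum_le_sum_of_subset_of_nonneg himg fun s _ _ => ?_)
    · rw [Finset.sum_image hinj]
      refine Finset.sum_congr rfl fun G _ => ?_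
      rw [hsingle, Finset.prod_mul_distrib, Finset.prod_const, Finset.prod_const, Real.exp_sum]
      ring
    · exact mul_nonneg (Finset.prod_nonneg fun e _ => by positivity)
        (Finset.prod_nonneg fun e _ => hp1)
  have hmark : (binomialRandom V p).real 𝒜 ≤ ∑ G : SimpleGraph V, (binomialRandom V p).real {G} *
      (Real.exp (-t) * Real.exp (∑ e ∈ G.edgeFinset, c e)) := by
    have h1 : (binomialRandom V p).real 𝒜 ≤
        ∑ G ∈ Finset.univ.filter (· ∈ 𝒜), (binomialRandom V p).real {G} := by
      refine le_trans (le_of_eq ?_) (measureReal_biUnion_finset_le _ _)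
      congr
      ext G
      simp
    refine h1.trans ?_
    refine le_trans (Finset.sum_le_sum fun G hG => ?_)
      (Finset.sum_le_univ_sum_of_nonneg fun G => by positivity)
    rw [← Real.exp_add]
    refine le_mul_of_one_le_right measureReal_nonneg (Real.one_le_exp ?_)
    linarith [h𝒜 G (Finset.mem_filter.1 hG).2]
  refine hmark.trans ?_
  have h2 : ∏ e ∈ E₀, ((p : ℝ) * Real.exp (c e) + (1 - p)) ≤
      Real.exp (p * ∑ e ∈ E₀, (Real.exp (c e) - 1)) := by
    rw [Finset.mul_sum, Real.exp_sum]
    refine Finset.prod_le_prod (fun e _ => by positivity) fun e _ => ?_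
    have := Real.add_one_le_exp ((p : ℝ) * (Real.exp (c e) - 1))
    linarith
  rw [Real.exp_add]
  refine le_trans (le_of_eq ?_) (mul_le_mul_of_nonneg_left (hprod.trans h2) (Real.exp_pos _).le)
  rw [Finset.mul_sum]
  exact Finset.sum_congr rfl fun G _ => by ring

open scoped Classical in
theorem sum_degIn_eq_sum_edgeFinset (G : SimpleGraph V) (X A : Finset V) :
    ∑ v ∈ X, degIn G v A =
      ∑ e ∈ G.edgeFinset, ((X ×ˢ A).filter fun q => s(q.1, q.2) = e).card := by
  have h1 : ∑ v ∈ X, degIn G v A = ((X ×ˢ A).filter fun q => G.Adj q.1 q.2).card := by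
    rw [Finset.card_filter, Finset.sum_product]
    refine Finset.sum_congr rfl fun v _ => ?_
    rw [degIn, Finset.card_filter]
  rw [h1, Finset.card_eq_sum_card_fiberwise (f := fun q => s(q.1, q.2)) (t := G.edgeFinset)]
  · refine Finset.sum_congr rfl fun e he => ?_
    congr 1
    ext q
    simp only [Finset.mem_filter]
    constructor
    · tauto
    · rintro ⟨hq, rfl⟩
      exact ⟨⟨hq, by simpa using he⟩, rfl⟩
  · intro q hq
    simpa using (Finset.mem_filter.1 hq).2

open scoped Classical in
/-- Exponential tail bound for the number of edges between two vertex sets of the binomial random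
graph. -/
theorem binomialRandom_real_sum_degIn_le (p : unitInterval) (X A : Finset V) (l t : ℝ) :
    (binomialRandom V p).real {G | t ≤ l * ((∑ v ∈ X, degIn G v A : ℕ) : ℝ)} ≤
      Real.exp (-t + p * (((X ×ˢ A).filter fun q => q.1 ≠ q.2).card *
        ((Real.exp (2 * l) - 1) / 2))) := by
  let cnt : Sym2 V → ℕ := fun e => ((X ×ˢ A).filter fun q => s(q.1, q.2) = e).card
  have hcnt : ∀ e, cnt e ≤ 2 := by
    intro e
    induction e using Sym2.ind with
    | h a b =>
      have : ((X ×ˢ A).filter fun q => s(q.1, q.2) = s(a, b)) ⊆ {(a, b), (b, a)} := by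
        rintro ⟨u, v⟩ hq
        have := (Finset.mem_filter.1 hq).2
        rw [Sym2.eq_iff] at this
        simp only [Finset.mem_insert, Finset.mem_singleton, Prod.mk.injEq]
        exact this
      exact (Finset.card_le_card this).trans Finset.card_le_two
  refine (binomialRandom_real_le_exp p (fun e => l * cnt e) t _ fun G hG => ?_).trans ?_
  · have hG' : t ≤ l * ((∑ v ∈ X, degIn G v A : ℕ) : ℝ) := hG
    rw [sum_degIn_eq_sum_edgeFinset, Nat.cast_sum, Finset.mul_sum] at hG'
    convert hG'
  · refine Real.exp_le_exp.2 (add_le_add_right ?_ _)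
    refine mul_le_mul_of_nonneg_left ?_ p.2.1
    have hsum : ∑ e ∈ Finset.univ.filter (fun e : Sym2 V => ¬ e.IsDiag), cnt e =
        ((X ×ˢ A).filter fun q => q.1 ≠ q.2).card := by
      rw [Finset.card_eq_sum_card_fiberwise (f := fun q => s(q.1, q.2))
        (t := Finset.univ.filter fun e : Sym2 V => ¬ e.IsDiag)]
      · refine Finset.sum_congr rfl fun e he => ?_
        simp only [cnt]
        congr 1
        ext q
        simp only [Finset.mem_filter]
        constructor
        · rintro ⟨hq, rfl⟩
          exact ⟨⟨hq, by simpa using he⟩, rfl⟩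
        · tauto
      · intro q hq
        simpa using (Finset.mem_filter.1 hq).2
    rw [← hsum, Nat.cast_sum, Finset.sum_mul]
    refine Finset.sum_le_sum fun e _ => ?_
    have h2 : Real.exp (2 * l) = Real.exp l * Real.exp l := by rw [← Real.exp_add]; ring_nf
    have h3 := hcnt e
    have h4 : cnt e = 0 ∨ cnt e = 1 ∨ cnt e = 2 := by omega
    -- An edge with both ends in X ∩ A is counted twice. Since (e^l - 1)² ≥ 0, a singly counted edge
    -- costs at most half of a doubly counted one, so the bound depends only on the number of
    -- ordered pairs.
    rcases h4 with h | h | h <;> rw [h]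
    · simp
    · rw [h2]
      norm_num
      nlinarith [sq_nonneg (Real.exp l - 1)]
    · rw [mul_comm l]
      norm_num
      linarith

end RandomGraph

/-! ### Failure probabilities of the pseudorandom properties -/

section TailBounds

open SimpleGraph MeasureTheory

theorem measureReal_exists_le {Ω ι : Type*} [MeasurableSpace Ω] (μ : Measure Ω) [IsFiniteMeasure μ]
    (s : Finset ι) (E : ι → Set Ω) (b : ι → ℝ) (h : ∀ i ∈ s, μ.real (E i) ≤ b i) :
    μ.real {ω | ∃ i ∈ s, ω ∈ E i} ≤ ∑ i ∈ s, b i := by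
  have : {ω | ∃ i ∈ s, ω ∈ E i} = ⋃ i ∈ s, E i := by ext ω; simp
  rw [this]
  exact (measureReal_biUnion_finset_le _ _).trans (Finset.sum_le_sum h)

variable {n : ℕ}

open scoped Classical in
theorem card_offDiag_le {V : Type} [Fintype V] (X A : Finset V) :
    (((X ×ˢ A).filter fun q => q.1 ≠ q.2).card : ℝ) ≤ X.card * A.card := by
  exact_mod_cast (Finset.card_filter_le _ _).trans (Finset.card_product X A).le

open scoped Classical in
theorem le_card_offDiag {V : Type} [Fintype V] (X A : Finset V) :
    (X.card * A.card - X.card : ℝ) ≤ ((X ×ˢ A).filter fun q => q.1 ≠ q.2).card := by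
  have h1 := Finset.card_filter_add_card_filter_not (s := X ×ˢ A) (fun q => q.1 = q.2)
  have h2 : ((X ×ˢ A).filter fun q => q.1 = q.2).card ≤ X.card := by
    refine Finset.card_le_card_of_injOn Prod.fst (fun q hq => ?_) fun q hq q' hq' h => ?_
    · exact (Finset.mem_product.1 (Finset.mem_filter.1 hq).1).1
    · have e1 := (Finset.mem_filter.1 hq).2
      have e2 := (Finset.mem_filter.1 hq').2
      exact Prod.ext h (e1.symm.trans (h.trans e2))
  rw [Finset.card_product] at h1
  have h3 : X.card * A.card ≤ ((X ×ˢ A).filter fun q => q.1 ≠ q.2).card + X.card := by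
    simp only [ne_eq]
    omega
  have h4 : (X.card * A.card : ℝ) ≤ ((X ×ˢ A).filter fun q => q.1 ≠ q.2).card + X.card := by
    exact_mod_cast h3
  linarith

/-- Tilting by 1/2 gives e^(-19N) for a fixed vertex; the union bound over n vertices is affordable
because N ≥ (log n)/2. -/
theorem binomialRandom_real_large_degree_le (hn : 1 ≤ n) (p : unitInterval)
    (hp : Real.log n ≤ 2 * (n * p)) :
    (binomialRandom (Fin n) p).real {G | ∃ v, 40 * (n * (p : ℝ)) < degIn G v Finset.univ} ≤
      Real.exp (-(5 * Real.log n)) := by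
  have hn0 : (0 : ℝ) < n := by exact_mod_cast hn
  have hlog : 0 ≤ Real.log n := Real.log_nonneg (by exact_mod_cast hn)
  have hN : 0 ≤ (n : ℝ) * p := mul_nonneg hn0.le p.2.1
  have h1 : ∀ v ∈ (Finset.univ : Finset (Fin n)), (binomialRandom (Fin n) p).real
      {G | 40 * (n * (p : ℝ)) < degIn G v Finset.univ} ≤ Real.exp (-(19 * (n * p))) := by
    intro v _
    have := binomialRandom_real_sum_degIn_le p {v} Finset.univ (1 / 2) (20 * (n * p))
    refine le_trans (measureReal_mono ?_) (this.trans (Real.exp_le_exp.2 ?_))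
    · intro G hG
      simp only [Set.mem_ofPred_eq, Finset.sum_singleton] at hG ⊢
      linarith
    · have h2 := card_offDiag_le {v} (Finset.univ : Finset (Fin n))
      simp only [Finset.card_singleton, Nat.cast_one, one_mul, Finset.card_univ,
        Fintype.card_fin] at h2
      have h3 : (Real.exp (2 * (1 / 2)) - 1) / 2 ≤ 1 := by
        have := Real.exp_one_lt_d9
        norm_num
        linarith
      have h4 : 0 ≤ (Real.exp (2 * (1 / 2)) - 1) / 2 := by
        have := Real.exp_one_gt_d9
        norm_num
        linarith
      have h5 := mul_le_mul h2 h3 h4 hn0.le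
      have h6 := mul_le_mul_of_nonneg_left h5 p.2.1
      linarith
  refine le_trans (measureReal_mono ?_) ((measureReal_exists_le _ _ _ _ h1).trans ?_)
  · rintro G ⟨v, hv⟩
    exact ⟨v, Finset.mem_univ _, hv⟩
  · rw [Finset.sum_const, Finset.card_univ, Fintype.card_fin, nsmul_eq_mul]
    nth_rw 1 [← Real.exp_log hn0]
    rw [← Real.exp_add]
    exact Real.exp_le_exp.2 (by linarith)

theorem sum_exp_pairs_le (s : Finset (Finset (Fin n) × Finset (Fin n))) :
    ∑ _q ∈ s, Real.exp (-(4 * n)) ≤ Real.exp (-(2 * n)) := by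
  rw [Finset.sum_const, nsmul_eq_mul]
  have h1 : (s.card : ℝ) ≤ 2 ^ n * 2 ^ n := by
    have := Finset.card_le_univ s
    rw [Fintype.card_prod, Fintype.card_finset, Fintype.card_fin] at this
    exact_mod_cast this
  have h2 : (2 : ℝ) ^ n ≤ Real.exp n := by
    rw [← mul_one (n : ℝ), Real.exp_nat_mul]
    exact pow_le_pow_left₀ (by norm_num) (by have := Real.exp_one_gt_d9; linarith) _
  have h3 : (s.card : ℝ) ≤ Real.exp n * Real.exp n :=
    h1.trans (mul_le_mul h2 h2 (by positivity) (Real.exp_pos _).le)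
  refine (mul_le_mul_of_nonneg_right h3 (Real.exp_pos _).le).trans (le_of_eq ?_)
  rw [← Real.exp_add, ← Real.exp_add]
  congr 1
  ring

theorem exp_sub_one_half_le {l : ℝ} (hl : |2 * l| ≤ 1) :
    (Real.exp (2 * l) - 1) / 2 ≤ l + 2 * l ^ 2 := by
  have := (abs_le.1 (Real.abs_exp_sub_one_sub_id_le hl)).2
  nlinarith

/-- With tilt θ/4 the exponent is at most -θ²p|X|n/8 ≤ -8n, which beats the 4^n choices of the two
sets. -/
theorem binomialRandom_real_upper_deviation_le (p : unitInterval) {θ K : ℝ} (hθ : 0 < θ)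
    (hθ1 : θ ≤ 1) (hK : 64 ≤ K * θ ^ 2) :
    (binomialRandom (Fin n) p).real {G | ∃ X A : Finset (Fin n), K ≤ (p : ℝ) * X.card ∧
      X.card * ((p : ℝ) * A.card + θ * (n * p)) ≤ ((∑ v ∈ X, degIn G v A : ℕ) : ℝ)} ≤
      Real.exp (-(2 * n)) := by
  classical
  have hn0 : (0 : ℝ) ≤ n := Nat.cast_nonneg _
  have hp0 : (0 : ℝ) ≤ p := p.2.1
  let s : Finset (Finset (Fin n) × Finset (Fin n)) :=
    Finset.univ.filter fun q => K ≤ (p : ℝ) * q.1.card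
  have h1 : ∀ q ∈ s, (binomialRandom (Fin n) p).real {G | q.1.card * ((p : ℝ) * q.2.card +
      θ * (n * p)) ≤ ((∑ v ∈ q.1, degIn G v q.2 : ℕ) : ℝ)} ≤ Real.exp (-(4 * n)) := by
    rintro ⟨X, A⟩ hq
    have hK' : K ≤ (p : ℝ) * X.card := (Finset.mem_filter.1 hq).2
    have := binomialRandom_real_sum_degIn_le p X A (θ / 4)
      (θ / 4 * (X.card * ((p : ℝ) * A.card + θ * (n * p))))
    refine le_trans (measureReal_mono ?_) (this.trans (Real.exp_le_exp.2 ?_))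
    · intro G hG
      simp only [Set.mem_ofPred_eq] at hG ⊢
      exact mul_le_mul_of_nonneg_left hG (by positivity)
    · have h2 := card_offDiag_le X A
      have h3 := exp_sub_one_half_le (l := θ / 4) (by rw [abs_of_nonneg] <;> linarith)
      have h4 : (0 : ℝ) ≤ θ / 4 + 2 * (θ / 4) ^ 2 := by positivity
      have h5 := mul_le_mul_of_nonneg_right h2 h4
      have h6 := mul_le_mul_of_nonneg_left
        ((mul_le_mul_of_nonneg_left h3 (Nat.cast_nonneg _)).trans h5) hp0
      have h7 : (A.card : ℝ) ≤ n := by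
        have := Finset.card_le_univ A
        rw [Fintype.card_fin] at this
        exact_mod_cast this
      have hX : (0 : ℝ) ≤ X.card := Nat.cast_nonneg _
      have h8 : (p : ℝ) * ((X.card : ℝ) * A.card * (2 * (θ / 4) ^ 2)) ≤
          p * ((X.card : ℝ) * n * (2 * (θ / 4) ^ 2)) :=
        mul_le_mul_of_nonneg_left (mul_le_mul_of_nonneg_right
          (mul_le_mul_of_nonneg_left h7 hX) (by positivity)) hp0
      have h9 : 64 * (n : ℝ) ≤ θ ^ 2 * (p * X.card) * n := by
        refine mul_le_mul_of_nonneg_right ?_ hn0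
        nlinarith [mul_le_mul_of_nonneg_right hK' (sq_nonneg θ)]
      nlinarith
  refine le_trans (measureReal_mono ?_) ((measureReal_exists_le _ _ _ _ h1).trans
    (sum_exp_pairs_le s))
  rintro G ⟨X, A, hX, hG⟩
  exact ⟨(X, A), Finset.mem_filter.2 ⟨Finset.mem_univ _, hX⟩, hG⟩

/-- As for the upper tail, but the |X| possible diagonal pairs must be discounted. The condition 4 ≤
θn makes their cost at most θ²p|X|n/16, leaving the exponent -4n when K θ² ≥ 64. -/
theorem binomialRandom_real_lower_deviation_le (p : unitInterval) {θ K : ℝ} (hθ : 0 < θ)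
    (hθ1 : θ ≤ 1) (hK : 64 ≤ K * θ ^ 2) (hn : 4 ≤ θ * n) :
    (binomialRandom (Fin n) p).real {G | ∃ X A : Finset (Fin n), K ≤ (p : ℝ) * X.card ∧
      ((∑ v ∈ X, degIn G v A : ℕ) : ℝ) ≤ X.card * ((p : ℝ) * A.card - θ * (n * p))} ≤
      Real.exp (-(2 * n)) := by
  classical
  have hn0 : (0 : ℝ) ≤ n := Nat.cast_nonneg _
  have hp0 : (0 : ℝ) ≤ p := p.2.1
  let s : Finset (Finset (Fin n) × Finset (Fin n)) :=
    Finset.univ.filter fun q => K ≤ (p : ℝ) * q.1.card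
  have h1 : ∀ q ∈ s, (binomialRandom (Fin n) p).real {G | ((∑ v ∈ q.1, degIn G v q.2 : ℕ) : ℝ) ≤
      q.1.card * ((p : ℝ) * q.2.card - θ * (n * p))} ≤ Real.exp (-(4 * n)) := by
    rintro ⟨X, A⟩ hq
    have hK' : K ≤ (p : ℝ) * X.card := (Finset.mem_filter.1 hq).2
    have := binomialRandom_real_sum_degIn_le p X A (-(θ / 4))
      (-(θ / 4) * (X.card * ((p : ℝ) * A.card - θ * (n * p))))
    refine le_trans (measureReal_mono ?_) (this.trans (Real.exp_le_exp.2 ?_))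
    · intro G hG
      simp only [Set.mem_ofPred_eq] at hG ⊢
      exact mul_le_mul_of_nonpos_left hG (by linarith)
    · have h2 := le_card_offDiag X A
      have h3 := exp_sub_one_half_le (l := -(θ / 4)) (by
        rw [mul_neg, abs_neg, abs_of_nonneg] <;> linarith)
      have h4 : -(θ / 4) + 2 * (-(θ / 4)) ^ 2 ≤ 0 := by nlinarith
      have h5 := mul_le_mul_of_nonpos_right h2 h4
      have h6 := mul_le_mul_of_nonneg_left
        ((mul_le_mul_of_nonneg_left h3 (Nat.cast_nonneg _)).trans h5) hp0
      have h7 : (A.card : ℝ) ≤ n := by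
        have := Finset.card_le_univ A
        rw [Fintype.card_fin] at this
        exact_mod_cast this
      have hX : (0 : ℝ) ≤ X.card := Nat.cast_nonneg _
      have h8 : (p : ℝ) * ((X.card : ℝ) * A.card * (2 * (θ / 4) ^ 2)) ≤
          p * ((X.card : ℝ) * n * (2 * (θ / 4) ^ 2)) :=
        mul_le_mul_of_nonneg_left (mul_le_mul_of_nonneg_right
          (mul_le_mul_of_nonneg_left h7 hX) (by positivity)) hp0
      have h9 : 64 * (n : ℝ) ≤ θ ^ 2 * (p * X.card) * n := by
        refine mul_le_mul_of_nonneg_right ?_ hn0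
        nlinarith [mul_le_mul_of_nonneg_right hK' (sq_nonneg θ)]
      have h10 : (p * X.card : ℝ) * θ * 4 ≤ (p * X.card : ℝ) * θ * (θ * n) :=
        mul_le_mul_of_nonneg_left hn (by positivity)
      have h11 : 0 ≤ (p * X.card : ℝ) * (2 * (θ / 4) ^ 2) := by positivity
      nlinarith
  refine le_trans (measureReal_mono ?_) ((measureReal_exists_le _ _ _ _ h1).trans
    (sum_exp_pairs_le s))
  rintro G ⟨X, A, hX, hG⟩
  exact ⟨(X, A), Finset.mem_filter.2 ⟨Finset.mem_univ _, hX⟩, hG⟩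

theorem choose_le_exp {a : ℕ} (ha : 1 ≤ a) (hn : 1 ≤ n) :
    (n.choose a : ℝ) ≤ Real.exp (a * (1 + Real.log (n / a))) := by
  have ha0 : (0 : ℝ) < a := by exact_mod_cast ha
  have hn0 : (0 : ℝ) < n := by exact_mod_cast hn
  have h1 : (n.choose a : ℝ) ≤ n ^ a / a.factorial := Nat.choose_le_pow_div a n
  have h2 : (a : ℝ) ^ a / a.factorial ≤ Real.exp a := Real.pow_div_factorial_le_exp a ha0.le a
  have h3 : (n : ℝ) ^ a / a.factorial = (n / a) ^ a * (a ^ a / a.factorial) := by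
    rw [div_pow]
    field_simp
  rw [mul_add, mul_one, Real.exp_add, Real.exp_nat_mul, Real.exp_log (by positivity), mul_comm]
  refine h1.trans (h3.le.trans (mul_le_mul_of_nonneg_left h2 (by positivity)))

/-- For a ≤ √n the logarithm is already large; for larger a one uses a ≥ 1 + log a. -/
theorem half_log_le_mul_log_div {a : ℕ} (ha : 1 ≤ a) (hn : 1 ≤ n)
    (hw : 1 ≤ Real.log (n / a)) : Real.log n / 2 ≤ a * Real.log (n / a) := by
  have ha0 : (0 : ℝ) < a := by exact_mod_cast ha
  have ha1 : (1 : ℝ) ≤ a := by exact_mod_cast ha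
  have hn0 : (0 : ℝ) < n := by exact_mod_cast hn
  rw [Real.log_div hn0.ne' ha0.ne'] at *
  have h1 := Real.log_le_sub_one_of_pos ha0
  by_cases h : Real.log a ≤ Real.log n / 2
  · nlinarith
  · nlinarith

/-- Here w stands for log(n/a), and the tilt w/80 grows with it. For y = e^(w/40) one has (p a y)^40
= (p a)^39 x^20 ≤ (K√x)^40, so the mean term is only of order aK√x. It and the entropy a(1+w) are
small against the gain wxa/80. -/
theorem sparse_exponent_le {x K w p a : ℝ} (hK : 1 ≤ K) (hx : 1000000 * K ^ 2 ≤ x)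
    (hw : 1 ≤ w) (ha : 0 ≤ a) (hp : 0 ≤ p)
    (hpa : p * a * Real.exp w = x ^ 20) (hpK : p * a ≤ K) :
    a * (1 + w) + (-(w / 80 * (x * a)) + p * (a * a * ((Real.exp (2 * (w / 80)) - 1) / 2))) ≤
      -(x / 400 * (a * w)) := by
  have hx1 : 1000000 ≤ x := by nlinarith
  obtain ⟨z, hz0, hz⟩ : ∃ z, 0 < z ∧ x = z * z :=
    ⟨Real.sqrt x, Real.sqrt_pos.2 (by linarith), (Real.mul_self_sqrt (by linarith)).symm⟩
  have hzK : 1000 * K ≤ z := by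
    by_contra! h
    nlinarith
  obtain ⟨y, hy⟩ : ∃ y, y = Real.exp (w / 40) := ⟨_, rfl⟩
  have hy0 : 0 < y := hy ▸ Real.exp_pos _
  have hyw : Real.exp w = y ^ 40 := by
    rw [hy, ← Real.exp_nat_mul]
    congr 1
    push_cast
    ring
  have hb : 0 ≤ p * a := mul_nonneg hp ha
  have hmain : p * a * y ≤ K * z := by
    by_contra! h
    have h1 : (K * z) ^ 40 < (p * a * y) ^ 40 :=
      pow_lt_pow_left₀ h (by positivity) (by norm_num)
    have h2 : (p * a * y) ^ 40 = (p * a) ^ 39 * x ^ 20 := by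
      rw [← hpa, hyw]; ring
    have h3 : (p * a) ^ 39 ≤ K ^ 39 := pow_le_pow_left₀ hb hpK 39
    have h4 : (K * z) ^ 40 = K ^ 39 * K * x ^ 20 := by rw [hz]; ring
    rw [h2, h4] at h1
    have h5 : (p * a) ^ 39 * x ^ 20 ≤ K ^ 39 * x ^ 20 :=
      mul_le_mul_of_nonneg_right h3 (by positivity)
    have h6 : K ^ 39 * x ^ 20 * 1 ≤ K ^ 39 * x ^ 20 * K :=
      mul_le_mul_of_nonneg_left hK (by positivity)
    linarith
  have e1 : Real.exp (2 * (w / 80)) = y := by rw [hy]; congr 1; ring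
  rw [e1]
  have h1 : p * (a * a * ((y - 1) / 2)) ≤ a * (K * z) / 2 := by
    have := mul_le_mul_of_nonneg_left hmain ha
    have : 0 ≤ p * a * a := mul_nonneg hb ha
    nlinarith
  have h2 : K * z ≤ x / 1000 := by rw [hz]; nlinarith
  have h3 : a * (K * z) ≤ a * (x / 1000 * w) := by
    refine mul_le_mul_of_nonneg_left (h2.trans ?_) ha
    nlinarith
  have h4 : a * (1 + w) ≤ a * (x / 1000 * w) := by
    refine mul_le_mul_of_nonneg_left ?_ ha
    nlinarith
  have h5 : 0 ≤ a * (x * w) := by positivity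
  nlinarith

/-- For each size a the failure probability of one set beats the number of sets by a factor n^(-6),
and at most n sizes occur. -/
theorem binomialRandom_real_not_locallySparse_le (hn : 1 ≤ n) (p : unitInterval) {x K : ℝ}
    (hK : 1 ≤ K) (hx : 1000000 * K ^ 2 ≤ x) (hxp : x ^ 20 = n * p) :
    (binomialRandom (Fin n) p).real {G | ¬ LocallySparse G (K / p) x} ≤
      Real.exp (-(5 * Real.log n)) := by
  classical
  have hn0 : (0 : ℝ) < n := by exact_mod_cast hn
  have hlog : 0 ≤ Real.log n := Real.log_nonneg (by exact_mod_cast hn)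
  have hx1 : 1000000 ≤ x := by nlinarith
  have hp0 : (0 : ℝ) < p := by
    have : 0 < (n : ℝ) * p := hxp ▸ pow_pos (by linarith) 20
    exact pos_of_mul_pos_right this hn0.le
  let s : Finset (Finset (Fin n)) := Finset.univ.filter fun A =>
    1 ≤ A.card ∧ (A.card : ℝ) ≤ K / p
  let b : ℕ → ℝ := fun a => if 1 ≤ a ∧ (a : ℝ) ≤ K / p then
    Real.exp (-(6 * Real.log n) - a * (1 + Real.log (n / a))) else 0
  have h1 : ∀ A ∈ s, (binomialRandom (Fin n) p).real {G | x * A.card <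
      ((∑ v ∈ A, degIn G v A : ℕ) : ℝ)} ≤ b A.card := by
    intro A hA
    obtain ⟨-, hA1, hAK⟩ := Finset.mem_filter.1 hA
    simp only [b, hA1, hAK, and_self, if_true]
    have ha0 : (0 : ℝ) < A.card := by exact_mod_cast hA1
    have hpK : p * (A.card : ℝ) ≤ K := by
      rw [le_div_iff₀ hp0] at hAK
      linarith
    obtain ⟨w, hw⟩ : ∃ w, w = Real.log (n / A.card) := ⟨_, rfl⟩
    have hexpw : Real.exp w = n / A.card := by rw [hw, Real.exp_log (by positivity)]
    have hpa : p * (A.card : ℝ) * Real.exp w = x ^ 20 := by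
      rw [hexpw, hxp]
      field_simp
    -- Sets of size at most K/p are a small fraction of all vertices, since x^20 = p a e^w is far
    -- larger than 3K.
    have hw1 : 1 ≤ w := by
      by_contra! h
      have h2 := Real.exp_lt_exp.2 h
      have h3 := Real.exp_one_lt_d9
      have h4 : x ^ 20 ≤ K * 3 := by
        rw [← hpa]
        exact mul_le_mul hpK (by linarith) (Real.exp_pos _).le (by linarith)
      have h5 : x ≤ x ^ 20 := le_self_pow₀ (by linarith) (by norm_num)
      nlinarith
    rw [← hw]
    have := binomialRandom_real_sum_degIn_le p A A (w / 80) (w / 80 * (x * A.card))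
    refine le_trans (measureReal_mono ?_) (this.trans (Real.exp_le_exp.2 ?_))
    · intro G hG
      simp only [Set.mem_ofPred_eq] at hG ⊢
      exact mul_le_mul_of_nonneg_left hG.le (by linarith)
    · have h2 := card_offDiag_le A A
      have h3 : 0 ≤ (Real.exp (2 * (w / 80)) - 1) / 2 := by
        have := Real.one_le_exp (show 0 ≤ 2 * (w / 80) by linarith)
        linarith
      have h4 := mul_le_mul_of_nonneg_left (mul_le_mul_of_nonneg_right h2 h3) hp0.le
      have h5 := sparse_exponent_le hK hx hw1 ha0.le hp0.le hpa hpK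
      have h6 := half_log_le_mul_log_div hA1 hn (hw ▸ hw1)
      rw [← hw] at h6
      have h7 : 6 * Real.log n ≤ x / 400 * (A.card * w) := by nlinarith
      linarith
  have hunion := measureReal_exists_le (binomialRandom (Fin n) p) s
    (fun A => {G | x * A.card < ((∑ v ∈ A, degIn G v A : ℕ) : ℝ)}) (fun A => b A.card) h1
  refine le_trans (measureReal_mono ?_) (hunion.trans ?_)
  · intro G hG
    simp only [LocallySparse, Set.mem_ofPred_eq, not_forall, not_le] at hG
    obtain ⟨A, hA, hG⟩ := hG
    refine ⟨A, Finset.mem_filter.2 ⟨Finset.mem_univ _, ?_, hA⟩, hG⟩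
    rw [Nat.one_le_iff_ne_zero, Ne, Finset.card_eq_zero]
    rintro rfl
    simp at hG
  · have hb0 : ∀ a, 0 ≤ b a := fun a => by
      simp only [b]
      split_ifs <;> positivity
    have h2 : ∑ A ∈ s, b A.card ≤ ∑ a ∈ Finset.range (n + 1), (n.choose a : ℝ) * b a := by
      refine (Finset.sum_le_univ_sum_of_nonneg fun A => hb0 _).trans (le_of_eq ?_)
      rw [← Finset.powerset_univ, Finset.sum_powerset_apply_card, Finset.card_univ,
        Fintype.card_fin]
      simp
    have h3 : ∀ a ∈ Finset.range (n + 1), (n.choose a : ℝ) * b a ≤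
        if 1 ≤ a then Real.exp (-(6 * Real.log n)) else 0 := by
      intro a _
      simp only [b]
      by_cases ha : 1 ≤ a
      · simp only [ha, true_and, if_true]
        split_ifs
        · refine (mul_le_mul_of_nonneg_right (choose_le_exp ha hn) (Real.exp_pos _).le).trans ?_
          rw [← Real.exp_add]
          exact Real.exp_le_exp.2 (by linarith)
        · rw [mul_zero]; positivity
      · simp [ha]
    refine h2.trans ((Finset.sum_le_sum h3).trans ?_)
    rw [Finset.sum_range_succ']
    simp only [Nat.le_add_left, if_true, Finset.sum_const, Finset.card_range, nsmul_eq_mul]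
    norm_num
    nth_rw 1 [← Real.exp_log hn0]
    rw [← Real.exp_add]
    exact Real.exp_le_exp.2 (by linarith)

end TailBounds

/-! ### The deterministic argument for a pseudorandom graph -/

section Deterministic

variable {n : ℕ} {G H : SimpleGraph (Fin n)}

/-- Few vertices have an exceptional number of neighbours in `S` or in its complement. -/
theorem exists_exceptional_set (S : Finset (Fin n)) {p θ K : ℝ} (hp : 0 < p)
    (hup : ∀ X A : Finset (Fin n), K ≤ p * X.card →
      ((∑ v ∈ X, degIn G v A : ℕ) : ℝ) < X.card * (p * A.card + θ * (n * p)))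
    (hlow : ∀ X A : Finset (Fin n), K ≤ p * X.card →
      X.card * (p * A.card - θ * (n * p)) < ((∑ v ∈ X, degIn G v A : ℕ) : ℝ)) :
    ∃ D : Finset (Fin n), (D.card : ℝ) ≤ 2 * K / p ∧ ∀ v ∉ D,
      (degIn G v S : ℝ) ≤ p * S.card + θ * (n * p) ∧
        p * (n - S.card) - θ * (n * p) ≤ (degIn G v Sᶜ : ℝ) := by
  classical
  let D₁ := Finset.univ.filter fun v => p * S.card + θ * (n * p) < (degIn G v S : ℝ)
  let D₂ := Finset.univ.filter fun v => (degIn G v Sᶜ : ℝ) < p * (n - S.card) - θ * (n * p)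
  have hSc : ((Sᶜ : Finset (Fin n)).card : ℝ) = n - S.card := by
    rw [Finset.card_compl, Fintype.card_fin, Nat.cast_sub]
    simpa using Finset.card_le_univ S
  have h1 : p * D₁.card < K := by
    by_contra! h
    have := hup D₁ S h
    rw [Nat.cast_sum, ← nsmul_eq_mul, ← Finset.sum_const] at this
    exact absurd this (not_lt.2 (Finset.sum_le_sum fun v hv => (Finset.mem_filter.1 hv).2.le))
  have h2 : p * D₂.card < K := by
    by_contra! h
    have := hlow D₂ Sᶜ h
    rw [Nat.cast_sum, ← nsmul_eq_mul, ← Finset.sum_const, hSc] at this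
    exact absurd this (not_lt.2 (Finset.sum_le_sum fun v hv => (Finset.mem_filter.1 hv).2.le))
  refine ⟨D₁ ∪ D₂, ?_, fun v hv => ?_⟩
  · rw [le_div_iff₀ hp]
    have : ((D₁ ∪ D₂).card : ℝ) ≤ D₁.card + D₂.card := by exact_mod_cast Finset.card_union_le _ _
    nlinarith
  · simp only [D₁, D₂, Finset.mem_union, Finset.mem_filter, Finset.mem_univ, true_and, not_or,
      not_lt] at hv
    exact hv

/-- In an `α`-residual subgraph, a non-exceptional vertex keeps more than half of its neighbours
outside of `S`. -/
theorem residual_degree_bounds {α ε δ θ p N n s dS dU hS hU : ℝ} (hα0 : 1 / 2 < α) (hα1 : α ≤ 1)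
    (hε0 : 0 < ε) (hε : ε ≤ 1 / 2) (hθ : θ = ε * (α - 1 / 2) / 16) (hδ : δ ≤ θ) (hδ0 : 0 ≤ δ)
    (hp : 0 < p) (hN : N = n * p) (hn : 4 ≤ θ * n) (hs0 : 0 ≤ s)
    (hs1 : s ≤ (1 - ε) * ((2 * α - 1) * n) + 1) (hs2 : s ≤ 2 * n / 3 + 1)
    (hdS : dS ≤ p * s + θ * N) (hdU : p * (n - s) - θ * N ≤ dU)
    (hres : α * (dS + dU) ≤ hS + hU) (hhS : hS ≤ dS) :
    (1 / 2 + δ) * dU + 10 * θ * N ≤ hU ∧ N / 10 ≤ hU := by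
  have hθ0 : 0 < θ := by rw [hθ]; have := mul_pos hε0 (sub_pos.2 hα0); linarith
  have hn0 : 0 < n := by
    by_contra! h
    nlinarith
  have hN0 : 0 < N := hN ▸ mul_pos hn0 hp
  have hθ1 : θ ≤ 1 / 64 := by rw [hθ]; nlinarith
  have hθα : θ ≤ α - 1 / 2 := by rw [hθ]; nlinarith
  have hpθ : 4 * p ≤ θ * N := by rw [hN]; nlinarith
  have h1 : (α - 1 / 2 - δ) * (p * (n - s) - θ * N) ≤ (α - 1 / 2 - δ) * dU :=
    mul_le_mul_of_nonneg_left hdU (by linarith)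
  have h2 : (1 - α) * dS ≤ (1 - α) * (p * s + θ * N) :=
    mul_le_mul_of_nonneg_left hdS (by linarith)
  have h3 : p * s ≤ p * ((1 - ε) * ((2 * α - 1) * n) + 1) := mul_le_mul_of_nonneg_left hs1 hp.le
  have h4 : p * s ≤ p * (2 * n / 3 + 1) := mul_le_mul_of_nonneg_left hs2 hp.le
  -- The factor 1-ε on |S| is worth 2ε(α - 1/2)N = 32θN by the choice of θ.
  have h5 : p * ((1 - ε) * ((2 * α - 1) * n) + 1) = (2 * α - 1) * N - 32 * (θ * N) + p := by
    rw [hθ, hN]; ring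
  have h6 : p * (n - s) = N - p * s := by rw [hN]; ring
  have h7 : 0 ≤ p * s := mul_nonneg hp.le hs0
  have h8 : 0 ≤ δ * (p * s) := mul_nonneg hδ0 h7
  have h9 : δ * N ≤ θ * N := mul_le_mul_of_nonneg_right hδ hN0.le
  have h10 : 0 ≤ δ * (θ * N) := by positivity
  have h11 : p * (2 * n / 3 + 1) = 2 * N / 3 + p := by rw [hN]; ring
  have h12 : θ * N ≤ 1 / 64 * N := mul_le_mul_of_nonneg_right hθ1 hN0.le
  rw [h6] at h1 hdU
  -- From hU ≥ α dU - (1-α) dS, the excess over dU/2 is about (α - 1/2)N - ps/2 ≥ 16θN; the error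
  -- terms leave 10θN.
  have hmain : (1 / 2 + δ) * dU + 10 * θ * N ≤ hU := by nlinarith
  refine ⟨hmain, ?_⟩
  by_cases hdU0 : 0 ≤ dU
  · have := mul_nonneg hδ0 hdU0
    have := mul_pos hθ0 hN0
    nlinarith
  · nlinarith

/-- Converts the bounds in c/p into those of the theorem: δc ≤ 1 and c ≥ 1 give c ≤ 1/δ². -/
theorem mul_div_le_div_sq_mul {a b c δ p r : ℝ} (ha : 0 ≤ a) (hab : a ≤ b) (hr : 1 ≤ r)
    (hc : 1 ≤ c) (hδ : 0 < δ) (hδc : δ * c ≤ 1) (hp : 0 < p) :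
    a * (c / p) ≤ b * r / (δ ^ 2 * p) := by
  rw [← mul_div_assoc, div_le_div_iff₀ hp (by positivity)]
  have hδ1 : δ ≤ 1 := (le_mul_of_one_le_right hδ.le hc).trans hδc
  have h1 : δ * (δ * c) ≤ 1 := mul_le_one₀ hδ1 (by positivity) hδc
  have h2 : a * (δ * (δ * c)) ≤ a := mul_le_of_le_one_right ha h1
  have h3 : b ≤ b * r := le_mul_of_one_le_right (ha.trans hab) hr
  have h4 := mul_le_mul_of_nonneg_right (h2.trans (hab.trans h3)) hp.le
  calc a * c * (δ ^ 2 * p) = a * (δ * (δ * c)) * p := by ring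
    _ ≤ b * r * p := h4

theorem linearForest_absorption_of_pseudorandom {r : ℕ} (hr : 2 ≤ r) {C ε α δ θ K c x p : ℝ}
    (hε0 : 0 < ε) (hε : ε ≤ 1 / 2) (hα0 : 1 / 2 < α) (hα1 : α ≤ 1)
    (hθ : θ = ε * (α - 1 / 2) / 16) (hδθ : δ ≤ θ) (hδ0 : 0 < δ) (hδc : δ * c ≤ 1)
    (hK : 0 ≤ K) (hC : 0 ≤ C) (hc : c = 2 * K + 2 * C + 1) (hp : 0 < p) (hp1 : p ≤ 1)
    (hxp : x ^ 20 = n * p) (hx : 1000 ≤ x) (hxθ : 1 ≤ θ * x) (hn : 4 ≤ θ * n)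
    (hdeg : ∀ v, (degIn G v Finset.univ : ℝ) ≤ 40 * (n * p))
    (hup : ∀ X A : Finset (Fin n), K ≤ p * X.card →
      ((∑ v ∈ X, degIn G v A : ℕ) : ℝ) < X.card * (p * A.card + θ * (n * p)))
    (hlow : ∀ X A : Finset (Fin n), K ≤ p * X.card →
      X.card * (p * A.card - θ * (n * p)) < ((∑ v ∈ X, degIn G v A : ℕ) : ℝ))
    (hsparse : LocallySparse G (200 * c / p) x)
    (htrans : ∀ U : Finset (Fin n), (∀ v, (degIn H v Finset.univ : ℝ) ≤ 40 * x ^ 20) →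
      ∃ R : Finset (Fin n), (∀ v, (degIn H v R : ℝ) ≤ x ^ 4) ∧
        ∀ v, x ^ 20 / 20000 ≤ (degIn H v U : ℝ) → 3 * x < (degIn H v (R ∩ U) : ℝ))
    (hH : IsResidualSpanning α H G) (hH2 : ∀ v, 2 ≤ deg H v)
    (hdist : ∀ u v, u ≠ v → (deg H u : ℝ) ≤ n * p / 5000 → (deg H v : ℝ) ≤ n * p / 5000 →
      5 < H.edist u v)
    (P : H.Subgraph) (S : Set (Fin n)) (hP : IsLinearForest P) (hPS : P.verts = S)
    (hS : S.ncard = ⌊(1 - ε) * min ((2 * α - 1) * n)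
        (min (2 * α * n / r) (2 * n / (r + 1)))⌋₊ ∨
      S.ncard = ⌈(1 - ε) * min ((2 * α - 1) * n)
        (min (2 * α * n / r) (2 * n / (r + 1)))⌉₊)
    (hPC : (numPaths P : ℝ) ≤ C) :
    ∃ (T : Set (Fin n)) (Q : H.Subgraph),
      S ⊆ T ∧ IsLinearForest Q ∧ T ⊆ Q.verts ∧
      (∀ u ∈ Tᶜ, max (p * (Tᶜ).ncard / 5000)
        ((1 / 2 + δ) * (degInto G u Tᶜ : ℝ)) ≤ (degInto H u Tᶜ : ℝ)) ∧
      (n : ℝ) - S.ncard - 300 * r / (δ ^ 2 * p) ≤ ((Tᶜ).ncard : ℝ) ∧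
      ((P.edgeSet \ Q.edgeSet).ncard : ℝ) ≤ 2000 * r / (δ ^ 2 * p) ∧
      (numPaths Q : ℝ) ≤ 2000 * r / (δ ^ 2 * p) ∧
      (∀ c : Q.coe.ConnectedComponent, 3 ≤ c.supp.ncard) ∧
      (∀ v ∈ Q.verts, (v ∈ pathEndpoints Q → v ∈ Tᶜ) ∧
        (v ∉ pathEndpoints Q → v ∈ T)) ∧
      (∀ u ∈ Tᶜ, (degInto H u (pathEndpoints Q) : ℝ) ≤
        ((n : ℝ) * p) ^ ((1 : ℝ) / 5)) := by
  classical
  obtain ⟨S, rfl⟩ : ∃ S' : Finset (Fin n), (S' : Set (Fin n)) = S :=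
    ⟨S.toFinite.toFinset, by simp⟩
  rw [Set.ncard_coe_finset] at hS
  have hn0 : (0 : ℝ) ≤ n := Nat.cast_nonneg _
  have hx0 : 0 < x := by linarith
  have hrR : (2 : ℝ) ≤ r := by exact_mod_cast hr
  have hc1 : 1 ≤ c := by rw [hc]; linarith
  have hNx : 1000000 * x ≤ x ^ 20 := by
    have h1 : (1000 : ℝ) ^ 19 ≤ x ^ 19 := pow_le_pow_left₀ (by norm_num) hx 19
    rw [show x ^ 20 = x ^ 19 * x by ring]
    exact mul_le_mul_of_nonneg_right (le_trans (by norm_num) h1) hx0.le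
  have hθNx : x ≤ θ * x ^ 20 := by
    have h1 : (1 : ℝ) ≤ x ^ 18 := one_le_pow₀ (by linarith)
    rw [show θ * x ^ 20 = (θ * x) * x ^ 18 * x by ring]
    exact le_mul_of_one_le_left hx0.le (one_le_mul_of_one_le_of_one_le hxθ h1)
  obtain ⟨y, hy⟩ : ∃ y, y = (1 - ε) * min ((2 * α - 1) * n)
    (min (2 * α * n / r) (2 * n / (r + 1))) := ⟨_, rfl⟩
  rw [← hy] at hS
  have hmin0 : 0 ≤ min ((2 * α - 1) * (n : ℝ)) (min (2 * α * n / r) (2 * n / (r + 1))) := by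
    refine le_min (mul_nonneg (by linarith) hn0) (le_min ?_ ?_)
    · have : 0 ≤ 2 * α := by linarith
      positivity
    · positivity
  have hy0 : 0 ≤ y := hy ▸ mul_nonneg (by linarith) hmin0
  have hsy : (S.card : ℝ) ≤ y + 1 := by
    rcases hS with h | h
    · rw [h]
      have := Nat.floor_le hy0
      linarith
    · rw [h]
      exact (Nat.ceil_lt_add_one hy0).le
  have hs1 : (S.card : ℝ) ≤ (1 - ε) * ((2 * α - 1) * n) + 1 := by
    have : y ≤ (1 - ε) * ((2 * α - 1) * n) := hy ▸
      mul_le_mul_of_nonneg_left (min_le_left _ _) (by linarith)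
    linarith
  have hs2 : (S.card : ℝ) ≤ 2 * n / 3 + 1 := by
    have h1 : min ((2 * α - 1) * (n : ℝ)) (min (2 * α * n / r) (2 * n / (r + 1))) ≤ 2 * n / 3 :=
      (min_le_right _ _).trans ((min_le_right _ _).trans
        (div_le_div_of_nonneg_left (by positivity) (by norm_num) (by linarith)))
    have h2 : y ≤ 1 * (2 * n / 3) := hy ▸ mul_le_mul (by linarith) h1 hmin0 (by norm_num)
    linarith
  obtain ⟨D, hDc, hD⟩ := exists_exceptional_set S hp hup hlow
  have hgood : ∀ v ∉ D, (1 / 2 + δ) * (degIn G v Sᶜ : ℝ) + 10 * θ * x ^ 20 ≤ degIn H v Sᶜ ∧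
      x ^ 20 / 10 ≤ (degIn H v Sᶜ : ℝ) := by
    intro v hv
    have hsplit : ∀ F : SimpleGraph (Fin n),
        (deg F v : ℝ) = degIn F v S + degIn F v Sᶜ := by
      intro F
      rw [deg_eq_degIn_univ, ← Finset.union_compl S, degIn_union_disjoint disjoint_compl_right]
      push_cast
      rfl
    have hres := hH.2 v
    rw [hsplit, hsplit] at hres
    have h1 := hD v hv
    rw [← hxp] at h1
    exact residual_degree_bounds hα0 hα1 hε0 hε hθ hδθ hδ0.le hp hxp hn (Nat.cast_nonneg _) hs1 hs2
      h1.1 h1.2 hres (by exact_mod_cast degIn_mono_left hH.1)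
  let L : Finset (Fin n) := Finset.univ.filter fun v => (deg H v : ℝ) ≤ x ^ 20 / 5000
  have hL : ∀ v, v ∈ L ↔ (deg H v : ℝ) ≤ x ^ 20 / 5000 := fun v => by simp [L]
  have hLD : L ⊆ D := by
    intro v hv
    by_contra hvD
    have h1 := (hgood v hvD).2
    have h2 := (hL v).1 hv
    rw [deg_eq_degIn_univ] at h2
    have h3 : (degIn H v Sᶜ : ℝ) ≤ degIn H v Finset.univ := by
      exact_mod_cast degIn_mono (Finset.subset_univ _)
    linarith
  -- Lets the bounded number of endpoints of `P` be counted among the O(1/p) exceptional vertices.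
  have hcp : c ≤ c / p := by
    rw [le_div_iff₀ hp]
    nlinarith
  obtain ⟨B, Q, hDB, hBc, hBdeg, hQ, hQT, hlost, hnum, hthree, hends, hB6⟩ :=
    exists_absorbing_linearForest (c := c / p) hx hP S D hPS hH2 L hL
      (fun u hu v hv huv => hdist u v huv (hxp ▸ (hL u).1 hu) (hxp ▸ (hL v).1 hv)) hLD
      (fun v hv => (hgood v hv).2)
      (hDc.trans (div_le_div_of_nonneg_right (by linarith) hp.le))
      (by
        have h1 : ((pathEndpoints P).ncard : ℝ) ≤ 2 * numPaths P := by
          exact_mod_cast hP.ncard_pathEndpoints_le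
        linarith)
      (by rw [← mul_div_assoc]; exact hsparse.anti hH.1)
      (fun U => htrans U fun v => le_trans (by exact_mod_cast degIn_mono_left hH.1)
        ((hdeg v).trans_eq (by rw [hxp])))
  have hconst : ∀ a b : ℝ, 0 ≤ a → a ≤ b → a * (c / p) ≤ b * r / (δ ^ 2 * p) := by
    intro a b ha hab
    exact mul_div_le_div_sq_mul ha hab (by linarith) hc1 hδ0 hδc hp
  have hTc : (((S ∪ B : Finset (Fin n)) : Set (Fin n))ᶜ) = ((S ∪ B)ᶜ : Finset (Fin n)) := by simp
  refine ⟨((S ∪ B : Finset (Fin n)) : Set (Fin n)), Q, by simp, hQ, hQT, ?_, ?_,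
    hlost.trans (hconst _ _ (by norm_num) (by norm_num)),
    hnum.trans (hconst _ _ (by norm_num) (by norm_num)), hthree, hends, fun u _ => ?_⟩
  · intro u hu
    rw [hTc] at hu ⊢
    rw [Set.ncard_coe_finset, degInto_coe, degInto_coe]
    have huB : u ∉ B := by
      have : u ∉ S ∪ B := by simpa using hu
      exact fun h => this (Finset.mem_union_right _ h)
    have hu1 := hgood u fun h => huB (hDB h)
    have hu2 := hBdeg u huB
    have hsd : Sᶜ \ B = (S ∪ B)ᶜ := by ext z; simp
    have h3 : degIn H u Sᶜ ≤ degIn H u (Sᶜ \ B) + degIn H u B := degIn_sdiff_ge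
    rw [hsd] at h3
    have h4 : (degIn H u Sᶜ : ℝ) ≤ degIn H u (S ∪ B)ᶜ + degIn H u B := by exact_mod_cast h3
    have h5 : (degIn G u (S ∪ B)ᶜ : ℝ) ≤ degIn G u Sᶜ := by
      exact_mod_cast degIn_mono (Finset.compl_subset_compl.2 Finset.subset_union_left)
    have h6 : (((S ∪ B)ᶜ : Finset (Fin n)).card : ℝ) ≤ n := by
      have := Finset.card_le_univ ((S ∪ B)ᶜ : Finset (Fin n))
      rw [Fintype.card_fin] at this
      exact_mod_cast this
    refine max_le ?_ ?_
    · have h7 : p * (((S ∪ B)ᶜ : Finset (Fin n)).card : ℝ) ≤ p * n :=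
        mul_le_mul_of_nonneg_left h6 hp.le
      linarith
    · have h7 : (1 / 2 + δ) * (degIn G u (S ∪ B)ᶜ : ℝ) ≤ (1 / 2 + δ) * degIn G u Sᶜ :=
        mul_le_mul_of_nonneg_left h5 (by linarith)
      linarith
  · rw [hTc, Set.ncard_coe_finset, Set.ncard_coe_finset]
    have h1 := hBc.trans (hconst 6 300 (by norm_num) (by norm_num))
    have h2 : n ≤ (S ∪ B)ᶜ.card + (S.card + B.card) := by
      have h3 := Finset.card_compl_add_card (S ∪ B)
      rw [Fintype.card_fin] at h3
      have := Finset.card_union_le S B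
      omega
    have h4 : (n : ℝ) ≤ (S ∪ B)ᶜ.card + (S.card + B.card) := by exact_mod_cast h2
    linarith
  · refine (hB6 u).trans (le_of_eq ?_)
    rw [← hxp, ← Real.rpow_natCast x 20, ← Real.rpow_mul hx0.le, ← Real.rpow_natCast x 4]
    norm_num

end Deterministic

/-! ### From failure probabilities to the error term -/

section Asymptotic

open MeasureTheory SimpleGraph

theorem one_sub_measureReal_le {Ω : Type*} [MeasurableSpace Ω] (μ : Measure Ω)
    [IsProbabilityMeasure μ] (E B₁ B₂ B₃ B₄ : Set Ω)
    (h : ∀ ω, ω ∉ B₁ → ω ∉ B₂ → ω ∉ B₃ → ω ∉ B₄ → ω ∈ E) {b : ℝ} (h₁ : μ.real B₁ ≤ b)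
    (h₂ : μ.real B₂ ≤ b) (h₃ : μ.real B₃ ≤ b) (h₄ : μ.real B₄ ≤ b) :
    1 - μ.real E ≤ 4 * b := by
  have hsub : (Set.univ : Set Ω) ⊆ E ∪ (B₁ ∪ (B₂ ∪ (B₃ ∪ B₄))) := by
    intro ω _
    by_contra hω
    simp only [Set.mem_union, not_or] at hω
    exact hω.1 (h ω hω.2.1 hω.2.2.1 hω.2.2.2.1 hω.2.2.2.2)
  have e0 : (1 : ℝ) ≤ μ.real (E ∪ (B₁ ∪ (B₂ ∪ (B₃ ∪ B₄)))) := by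
    rw [← probReal_univ (μ := μ)]
    exact measureReal_mono hsub
  have e1 := measureReal_union_le (μ := μ) E (B₁ ∪ (B₂ ∪ (B₃ ∪ B₄)))
  have e2 := measureReal_union_le (μ := μ) B₁ (B₂ ∪ (B₃ ∪ B₄))
  have e3 := measureReal_union_le (μ := μ) B₂ (B₃ ∪ B₄)
  have e4 := measureReal_union_le (μ := μ) B₃ B₄
  linarith

theorem tendsto_natCast_mul_atTop_of_log_le {p : ℕ → unitInterval}
    (hp : ∀ᶠ n : ℕ in atTop, Real.log n / (2 * n) ≤ (p n : ℝ)) :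
    Tendsto (fun n : ℕ => (n : ℝ) * p n) atTop atTop := by
  have h1 : Tendsto (fun n : ℕ => Real.log n / 2) atTop atTop :=
    (Real.tendsto_log_atTop.comp tendsto_natCast_atTop_atTop).atTop_div_const (by norm_num)
  refine tendsto_atTop_mono' _ ?_ h1
  filter_upwards [hp, eventually_ge_atTop 1] with n hn hn1
  have hn0 : (0 : ℝ) < n := by exact_mod_cast hn1
  rw [div_le_iff₀ (by positivity)] at hn
  linarith

theorem isLittleO_inv_cube_of_le {f : ℕ → ℝ} (h0 : ∀ n, 0 ≤ f n)
    (h : ∀ᶠ n : ℕ in atTop, f n ≤ 4 * Real.exp (-(5 * Real.log n))) :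
    f =o[atTop] (fun n : ℕ => ((n : ℝ) ^ 3)⁻¹) := by
  refine isLittleO_iff.2 fun c hc => ?_
  filter_upwards [h, eventually_ge_atTop 1,
    tendsto_natCast_atTop_atTop.eventually_ge_atTop (4 / c)] with n hn hn1 hnc
  have hn0 : (0 : ℝ) < n := by exact_mod_cast hn1
  have hn1' : (1 : ℝ) ≤ n := by exact_mod_cast hn1
  have hexp : Real.exp (-(5 * Real.log n)) = ((n : ℝ) ^ 3)⁻¹ * ((n : ℝ) ^ 2)⁻¹ := by
    rw [Real.exp_neg, ← mul_inv, ← pow_add,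
      show (5 : ℝ) * Real.log n = ((5 : ℕ) : ℝ) * Real.log n by norm_num, Real.exp_nat_mul,
      Real.exp_log hn0]
  rw [Real.norm_of_nonneg (h0 n), Real.norm_of_nonneg (by positivity)]
  refine hn.trans ?_
  rw [hexp]
  have h1 : 4 * ((n : ℝ) ^ 2)⁻¹ ≤ c := by
    rw [← div_eq_mul_inv, div_le_iff₀ (by positivity)]
    rw [div_le_iff₀ hc] at hnc
    nlinarith
  have h2 := mul_le_mul_of_nonneg_left h1 (show 0 ≤ ((n : ℝ) ^ 3)⁻¹ by positivity)
  linarith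

end Asymptotic

/-! ### Choice of constants and conclusion -/

theorem mainTheorem11 (r : ℕ) (hr : 2 ≤ r) (C : ℝ) (hC : 0 ≤ C)
    (ε : ℝ) (hε0 : 0 < ε) (hε : ε ≤ 1 / 2)
    (α : ℝ) (hα0 : 1 / 2 + 1 / (2 * (r : ℝ)) ≤ α) (hα1 : α ≤ 1) :
    ∃ δ : ℝ, 0 < δ ∧
      ∀ p : ℕ → unitInterval,
        (∀ᶠ n : ℕ in atTop, Real.log n / (2 * n) ≤ (p n : ℝ)) →
        (fun n : ℕ => 1 - (SimpleGraph.binomialRandom (Fin n) (p n)).real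
          {G : SimpleGraph (Fin n) |
            ∀ H : SimpleGraph (Fin n), IsResidualSpanning α H G →
              -- minimum degree at least two
              (∀ v, 2 ≤ deg H v) →
              -- no two low-degree vertices are within distance five in `H`
              (∀ u v, u ≠ v → (deg H u : ℝ) ≤ n * (p n : ℝ) / 5000 →
                (deg H v : ℝ) ≤ n * (p n : ℝ) / 5000 → 5 < H.edist u v) →
              ∀ (P : H.Subgraph) (S : Set (Fin n)), IsLinearForest P → P.verts = S →
                -- `|S|` is the prescribed real number, rounded down or up
                (S.ncard = ⌊(1 - ε) * min ((2 * α - 1) * n)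
                    (min (2 * α * n / r) (2 * n / (r + 1)))⌋₊ ∨
                  S.ncard = ⌈(1 - ε) * min ((2 * α - 1) * n)
                    (min (2 * α * n / r) (2 * n / (r + 1)))⌉₊) →
                (numPaths P : ℝ) ≤ C →
                ∃ (T : Set (Fin n)) (Q : H.Subgraph),
                  S ⊆ T ∧ IsLinearForest Q ∧ T ⊆ Q.verts ∧
                  -- minimum degree inside `U = Tᶜ`
                  (∀ u ∈ Tᶜ, max ((p n : ℝ) * (Tᶜ).ncard / 5000)
                    ((1 / 2 + δ) * (degInto G u Tᶜ : ℝ)) ≤ (degInto H u Tᶜ : ℝ)) ∧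
                  -- size of `U`
                  (n : ℝ) - S.ncard - 300 * r / (δ ^ 2 * (p n : ℝ)) ≤ ((Tᶜ).ncard : ℝ) ∧
                  -- edges of `P` that are lost
                  ((P.edgeSet \ Q.edgeSet).ncard : ℝ) ≤ 2000 * r / (δ ^ 2 * (p n : ℝ)) ∧
                  -- number of paths
                  (numPaths Q : ℝ) ≤ 2000 * r / (δ ^ 2 * (p n : ℝ)) ∧
                  -- all paths have at least three vertices, ends in `U`, all other vertices in `T`
                  (∀ c : Q.coe.ConnectedComponent, 3 ≤ c.supp.ncard) ∧
                  (∀ v ∈ Q.verts, (v ∈ pathEndpoints Q → v ∈ Tᶜ) ∧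
                    (v ∉ pathEndpoints Q → v ∈ T)) ∧
                  -- few endpoints next to any vertex of `U`
                  (∀ u ∈ Tᶜ, (degInto H u (pathEndpoints Q) : ℝ) ≤
                    ((n : ℝ) * (p n : ℝ)) ^ ((1 : ℝ) / 5))})
        =o[atTop] (fun n : ℕ => ((n : ℝ) ^ 3)⁻¹) := by
  have hr0 : (0 : ℝ) < r := by
    have : (2 : ℝ) ≤ r := by exact_mod_cast hr
    linarith
  have hα : 1 / 2 < α := by
    have : (0 : ℝ) < 1 / (2 * (r : ℝ)) := by positivity
    linarith
  obtain ⟨θ, hθ⟩ : ∃ θ, θ = ε * (α - 1 / 2) / 16 := ⟨_, rfl⟩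
  have hθ0 : 0 < θ := by
    rw [hθ]
    have := mul_pos hε0 (sub_pos.2 hα)
    linarith
  have hθ1 : θ ≤ 1 := by rw [hθ]; nlinarith
  -- The least K for which the deviation bounds survive the union over all pairs of sets.
  obtain ⟨K, hK⟩ : ∃ K, K = 64 / θ ^ 2 := ⟨_, rfl⟩
  have hK0 : 0 ≤ K := by rw [hK]; positivity
  have hKθ : 64 ≤ K * θ ^ 2 := by rw [hK, div_mul_cancel₀ _ (by positivity)]
  obtain ⟨c, hc⟩ : ∃ c, c = 2 * K + 2 * C + 1 := ⟨_, rfl⟩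
  have hc1 : 1 ≤ c := by rw [hc]; linarith
  have hc0 : 0 < c := by linarith
  -- The bound θ keeps δ within the slack of the degree estimate; 1/c turns multiples of c/p into
  -- the required bounds in 1/(δ²p).
  obtain ⟨δ, hδ⟩ : ∃ δ, δ = min θ (1 / c) := ⟨_, rfl⟩
  have hδ0 : 0 < δ := hδ ▸ lt_min hθ0 (by positivity)
  have hδθ : δ ≤ θ := hδ ▸ min_le_left _ _
  have hδc : δ * c ≤ 1 := by
    rw [← le_div_iff₀ hc0, hδ]
    exact min_le_right _ _
  refine ⟨δ, hδ0, fun p hp => ?_⟩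
  refine isLittleO_inv_cube_of_le (fun n => sub_nonneg.2 MeasureTheory.measureReal_le_one) ?_
  have hN := tendsto_natCast_mul_atTop_of_log_le hp
  have hx := (tendsto_rpow_atTop (show (0 : ℝ) < 1 / 20 by norm_num)).comp hN
  have hlog : ∀ᶠ n : ℕ in atTop, 5 * Real.log n ≤ 2 * (n : ℝ) := by
    have h1 := (Real.isLittleO_log_id_atTop.comp_tendsto
      (tendsto_natCast_atTop_atTop (R := ℝ))).bound (show (0 : ℝ) < 2 / 5 by norm_num)
    filter_upwards [h1] with n hn
    simp only [Function.comp, id, Real.norm_eq_abs] at hn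
    have := le_abs_self (Real.log n)
    have hn' : |(n : ℝ)| = n := abs_of_nonneg (Nat.cast_nonneg n)
    rw [hn'] at hn
    linarith
  filter_upwards [hp, eventually_ge_atTop 1, hlog, hN.eventually_gt_atTop 0,
    tendsto_natCast_atTop_atTop.eventually_ge_atTop (4 / θ), hx.eventually_ge_atTop 1000,
    hx.eventually_ge_atTop (1 / θ), hx.eventually_ge_atTop (1000000 * (200 * c) ^ 2),
    hx.eventually eventually_exists_sparse_transversal]
    with n hpn hn1 hlogn hN0 hnθ hx1 hx2 hx3 hx4
  simp only [Function.comp] at hx1 hx2 hx3 hx4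
  obtain ⟨x, hxdef⟩ : ∃ x, x = ((n : ℝ) * p n) ^ ((1 : ℝ) / 20) := ⟨_, rfl⟩
  rw [← hxdef] at hx1 hx2 hx3 hx4
  have hxp : x ^ 20 = n * p n := by
    rw [hxdef, ← Real.rpow_natCast, ← Real.rpow_mul hN0.le]
    norm_num
  have hn0 : (0 : ℝ) < n := by exact_mod_cast hn1
  have hp0 : 0 < (p n : ℝ) := pos_of_mul_pos_right hN0 hn0.le
  have hpn' : Real.log n ≤ 2 * (n * (p n : ℝ)) := by
    rw [div_le_iff₀ (by positivity)] at hpn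
    linarith
  have hnθ' : 4 ≤ θ * n := by
    rw [div_le_iff₀ hθ0] at hnθ
    linarith
  have hxθ : 1 ≤ θ * x := by
    rw [div_le_iff₀ hθ0] at hx2
    linarith
  have hexp : Real.exp (-(2 * (n : ℝ))) ≤ Real.exp (-(5 * Real.log n)) :=
    Real.exp_le_exp.2 (by linarith)
  refine one_sub_measureReal_le _ _ _ _ _ _ ?_
    (binomialRandom_real_large_degree_le hn1 (p n) hpn')
    ((binomialRandom_real_upper_deviation_le (p n) hθ0 hθ1 hKθ).trans hexp)
    ((binomialRandom_real_lower_deviation_le (p n) hθ0 hθ1 hKθ hnθ').trans hexp)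
    (binomialRandom_real_not_locallySparse_le hn1 (p n) (K := 200 * c) (by linarith) hx3 hxp)
  intro G h1 h2 h3 h4
  simp only [Set.mem_ofPred_eq, not_exists, not_and, not_lt, not_le, not_not] at h1 h2 h3 h4
  intro H hH hH2 hdist P S hP hPS hS hPC
  exact linearForest_absorption_of_pseudorandom hr hε0 hε hα hα1 hθ hδθ hδ0 hδc hK0 hC hc hp0
    (p n).2.2 hxp hx1 hxθ hnθ' h1 h2 h3 h4 (fun U => by convert hx4 (Fin n) H U) hH hH2 hdist P S hP hPS hS
    hPC
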